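/- Let $\mathbb{K}$ be a field, $d\ge 0$ an integer, $\mathcal{A}$ a $\mathbb{K}$-algebra isomorphic to the algebra of $(d+1)\times(d+1)$ matrices over $\mathbb{K}$, and $V$ a simple $\mathcal{A}$-module. An element of $\mathcal{A}$ is *multiplicity-free* if it has $d+1$ distinct eigenvalues in $\mathbb{K}$; if these are $\theta_0,\dots,\theta_d$, the primitive idempotent of $A$ associated with $\theta_i$ is $\prod_{j\ne i}(A-\theta_jI)/(\theta_i-\theta_j)$. A *Leonard system* in $\mathcal{A}$ is a sequence $\Phi=(A;\{E_i\}_{i=0}^d;A^*;\{E^*_i\}_{i=0}^d)$ such that $A,A^*\in\mathcal{A}$ are multiplicity-free, $E_0,\dots,E_d$ (resp. $E^*_0,\dots,E^*_d$) is an ordering of the primitive idempotents of $A$ (resp. $A^*$), and both $E_iA^*E_j$ and $E^*_iAE^*_j$ are zero if $|i-j|>1$ and nonzero if $|i-j|=1$. Let $\Phi$ be a Leonard system in $\mathcal{A}$. Let $\theta_i$ (resp. $\theta^*_i$) be the eigenvalue of $A$ (resp. $A^*$) associated with $E_i$ (resp. $E^*_i$). The *first split sequence* of $\Phi$ is the unique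 sequence of nonzero scalars $\varphi_1,\dots,\varphi_d$ in $\mathbb{K}$ for which $V$ has a basis $u_0,\dots,u_d$ with $Au_i=\theta_iu_i+u_{i+1}$ $(0\le i<d)$, $Au_d=\theta_du_d$, $A^*u_i=\varphi_iu_{i-1}+\theta^*_iu_i$ $(1\le i\le d)$, $A^*u_0=\theta^*_0u_0$. The *second split sequence* $\phi_1,\dots,\phi_d$ of $\Phi$ is the first split sequence of the Leonard system $(A;\{E_{d-i}\}_{i=0}^d;A^*;\{E^*_i\}_{i=0}^d)$. For $0\le i\le d$ define polynomials $$\tau_i=\prod_{k=0}^{i-1}(\lambda-\theta_k),\quad \eta_i=\prod_{k=0}^{i-1}(\lambda-\theta_{d-k}),\quad \tau^*_i=\prod_{k=0}^{i-1}(\lambda-\theta^*_k),\quad \eta^*_i=\prod_{k=0}^{i-1}(\lambda-\theta^*_{d-k}).$$ If $d\ge3$, let $\beta\in\mathbb{K}$ be such that $\beta+1$ is the common value of the expressions $$\frac{\theta_{i-2}-\theta_{i+1}}{\theta_{i-1}-\theta_i},\qquad \frac{\theta^*_{i-2}-\theta^*_{i+1}}{\theta^*_{i-1}-\theta^*_i}\qquad(2\le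 i\le d-1)$$ (it is known that these are all equal, so that $\beta+1=(\theta_0-\theta_3)/(\theta_1-\theta_2)$); if $d\le2$, let $\beta\in\mathbb{K}$ be arbitrary. Let $q$ be a nonzero element of the algebraic closure $\overline{\mathbb{K}}$ with $\beta=q+q^{-1}$, and assume $q\ne1$, $q\ne-1$. Fix a square root $q^{1/2}$ of $q$ in $\overline{\mathbb{K}}$, and put $$[n]=\frac{q^{n/2}-q^{-n/2}}{q^{1/2}-q^{-1/2}},\qquad [n]^!=[n][n-1]\cdots[1],\qquad [r,s,t]=\frac{[r+s]^!\,[r+t]^!\,[s+t]^!}{[r]^!\,[s]^!\,[t]^!\,[r+s+t]^!}$$ for nonnegative integers $n$ and $r,s,t$ with $r+s+t\le d$. Then for $1\le i\le d$ the following eight identities hold: $$\frac{\phi_1\cdots\phi_i}{(\theta^*_0-\theta^*_1)\cdots(\theta^*_0-\theta^*_i)}=\sum_{h=0}^i\frac{[h,i-h,d-i]\,\eta_{i-h}(\theta_0)\,\varphi_1\cdots\varphi_h}{(\theta^*_0-\theta^*_1)\cdots(\theta^*_0-\theta^*_h)},$$ $$\frac{\varphi_d\cdots\varphi_{d-i+1}}{(\theta^*_d-\theta^*_{d-1})\cdots(\theta^*_d-\theta^*_{d-i})}=\sum_{h=0}^i\frac{[h,i-h,d-i]\,\eta_{i-h}(\theta_0)\,\phi_d\cdots\phi_{d-h+1}}{(\theta^*_d-\theta^*_{d-1})\cdots(\theta^*_d-\theta^*_{d-h})},$$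 $$\frac{\varphi_1\cdots\varphi_i}{(\theta^*_0-\theta^*_1)\cdots(\theta^*_0-\theta^*_i)}=\sum_{h=0}^i\frac{[h,i-h,d-i]\,\tau_{i-h}(\theta_d)\,\phi_1\cdots\phi_h}{(\theta^*_0-\theta^*_1)\cdots(\theta^*_0-\theta^*_h)},$$ $$\frac{\phi_d\cdots\phi_{d-i+1}}{(\theta^*_d-\theta^*_{d-1})\cdots(\theta^*_d-\theta^*_{d-i})}=\sum_{h=0}^i\frac{[h,i-h,d-i]\,\tau_{i-h}(\theta_d)\,\varphi_d\cdots\varphi_{d-h+1}}{(\theta^*_d-\theta^*_{d-1})\cdots(\theta^*_d-\theta^*_{d-h})},$$ $$\frac{\phi_d\cdots\phi_{d-i+1}}{(\theta_0-\theta_1)\cdots(\theta_0-\theta_i)}=\sum_{h=0}^i\frac{[h,i-h,d-i]\,\eta^*_{i-h}(\theta^*_0)\,\varphi_1\cdots\varphi_h}{(\theta_0-\theta_1)\cdots(\theta_0-\theta_h)},$$ $$\frac{\varphi_d\cdots\varphi_{d-i+1}}{(\theta_d-\theta_{d-1})\cdots(\theta_d-\theta_{d-i})}=\sum_{h=0}^i\frac{[h,i-h,d-i]\,\eta^*_{i-h}(\theta^*_0)\,\phi_1\cdots\phi_h}{(\theta_d-\theta_{d-1})\cdots(\theta_d-\theta_{d-h})},$$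 $$\frac{\varphi_1\cdots\varphi_i}{(\theta_0-\theta_1)\cdots(\theta_0-\theta_i)}=\sum_{h=0}^i\frac{[h,i-h,d-i]\,\tau^*_{i-h}(\theta^*_d)\,\phi_d\cdots\phi_{d-h+1}}{(\theta_0-\theta_1)\cdots(\theta_0-\theta_h)},$$ $$\frac{\phi_1\cdots\phi_i}{(\theta_d-\theta_{d-1})\cdots(\theta_d-\theta_{d-i})}=\sum_{h=0}^i\frac{[h,i-h,d-i]\,\tau^*_{i-h}(\theta^*_d)\,\varphi_d\cdots\varphi_{d-h+1}}{(\theta_d-\theta_{d-1})\cdots(\theta_d-\theta_{d-h})}.$$ -/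

import Mathlib

open Polynomial

section LeonardSystems

variable {K 𝒜 : Type*} [Field K] [Ring 𝒜] [Algebra K 𝒜] {d : ℕ}

/-- `A` is multiplicity-free: it has `d + 1` mutually distinct eigenvalues in `K`.
Here `𝒜` is isomorphic to the algebra of `d + 1` by `d + 1` matrices, so an eigenvalue of `A`
is the same thing as an element of the spectrum of `A`. -/
def IsMultiplicityFree (K : Type*) {𝒜 : Type*} [Field K] [Ring 𝒜] [Algebra K 𝒜]
    (d : ℕ) (A : 𝒜) : Prop :=
  ∃ θ : Fin (d + 1) → K, Function.Injective θ ∧ ∀ i, θ i ∈ spectrum K A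

/-- The element `∏_{j ≠ i} (A - θ_j I) / (θ_i - θ_j)`. -/
noncomputable def primitiveIdempotent (A : 𝒜) (θ : Fin (d + 1) → K) (i : Fin (d + 1)) : 𝒜 :=
  aeval A (∏ j ∈ Finset.univ.erase i, C (θ i - θ j)⁻¹ * (X - C (θ j)))

/-- `θ` is an ordering of the eigenvalues of `A`, and for all `i` the element `E i` is the
primitive idempotent of `A` associated with `θ i`. -/
def IsAssociatedOrdering (A : 𝒜) (E : Fin (d + 1) → 𝒜) (θ : Fin (d + 1) → K) : Prop :=
  Function.Injective θ ∧ (∀ i, θ i ∈ spectrum K A) ∧ ∀ i, E i = primitiveIdempotent A θ i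

theorem IsAssociatedOrdering.rev {A : 𝒜} {E : Fin (d + 1) → 𝒜} {θ : Fin (d + 1) → K}
    (h : IsAssociatedOrdering A E θ) :
    IsAssociatedOrdering A (fun i => E i.rev) (fun i => θ i.rev) := by
  refine ⟨fun i j hij => Fin.rev_injective (h.1 hij), fun i => h.2.1 _, fun i => ?_⟩
  refine (h.2.2 i.rev).trans ?_
  unfold primitiveIdempotent
  congr 1
  refine Finset.prod_bij' (fun j _ => j.rev) (fun j _ => j.rev) ?_ ?_ ?_ ?_ ?_ <;>
    simp [Fin.rev_eq_iff]

/-- A Leonard system in `𝒜` over `K` of diameter `d` (the algebra `𝒜` is meant to be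
isomorphic to the algebra of `d + 1` by `d + 1` matrices over `K`). -/
structure LeonardSystem (K 𝒜 : Type*) [Field K] [Ring 𝒜] [Algebra K 𝒜] (d : ℕ) where
  A : 𝒜
  E : Fin (d + 1) → 𝒜
  Astar : 𝒜
  Estar : Fin (d + 1) → 𝒜
  multiplicityFree : IsMultiplicityFree K d A
  multiplicityFree_star : IsMultiplicityFree K d Astar
  ordering : ∃ θ : Fin (d + 1) → K, IsAssociatedOrdering A E θ
  ordering_star : ∃ θ : Fin (d + 1) → K, IsAssociatedOrdering Astar Estar θ
  E_Astar_E_eq_zero : ∀ i j : Fin (d + 1), 1 < |((i : ℕ) : ℤ) - ((j : ℕ) : ℤ)| →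
    E i * Astar * E j = 0
  E_Astar_E_ne_zero : ∀ i j : Fin (d + 1), |((i : ℕ) : ℤ) - ((j : ℕ) : ℤ)| = 1 →
    E i * Astar * E j ≠ 0
  Estar_A_Estar_eq_zero : ∀ i j : Fin (d + 1), 1 < |((i : ℕ) : ℤ) - ((j : ℕ) : ℤ)| →
    Estar i * A * Estar j = 0
  Estar_A_Estar_ne_zero : ∀ i j : Fin (d + 1), |((i : ℕ) : ℤ) - ((j : ℕ) : ℤ)| = 1 →
    Estar i * A * Estar j ≠ 0

theorem abs_rev_sub_rev (i j : Fin (d + 1)) :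
    |((i.rev : ℕ) : ℤ) - ((j.rev : ℕ) : ℤ)| = |((i : ℕ) : ℤ) - ((j : ℕ) : ℤ)| := by
  rw [Fin.val_rev, Fin.val_rev, ← abs_neg]
  congr 1
  omega

namespace LeonardSystem

/-- The relative `Φ^⇓ = (A; {E_{d-i}}; A*; {E*_i})` of `Φ`. -/
def dDown (Φ : LeonardSystem K 𝒜 d) : LeonardSystem K 𝒜 d where
  A := Φ.A
  E := fun i => Φ.E i.rev
  Astar := Φ.Astar
  Estar := Φ.Estar
  multiplicityFree := Φ.multiplicityFree
  multiplicityFree_star := Φ.multiplicityFree_star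
  ordering := Φ.ordering.elim fun _ h => ⟨_, h.rev⟩
  ordering_star := Φ.ordering_star
  E_Astar_E_eq_zero := fun i j h =>
    Φ.E_Astar_E_eq_zero i.rev j.rev (by rwa [abs_rev_sub_rev])
  E_Astar_E_ne_zero := fun i j h =>
    Φ.E_Astar_E_ne_zero i.rev j.rev (by rwa [abs_rev_sub_rev])
  Estar_A_Estar_eq_zero := Φ.Estar_A_Estar_eq_zero
  Estar_A_Estar_ne_zero := Φ.Estar_A_Estar_ne_zero

/-- The eigenvalue sequence: entry `i` is the eigenvalue of `A` associated with `E i`. -/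
noncomputable def eigenvalueSeq (Φ : LeonardSystem K 𝒜 d) : Fin (d + 1) → K :=
  Φ.ordering.choose

/-- The dual eigenvalue sequence: entry `i` is the eigenvalue of `A*` associated with `E* i`. -/
noncomputable def dualEigenvalueSeq (Φ : LeonardSystem K 𝒜 d) : Fin (d + 1) → K :=
  Φ.ordering_star.choose

section Split

variable (V : Type*) [AddCommGroup V] [Module K V] [Module 𝒜 V]

/-- `u` is a `Φ`-split basis of the `𝒜`-module `V`, with scalars `c`; the entry `c i` is the
scalar numbered `i + 1` in the usual numbering from `1` to `d`:
`A u_i = θ_i u_i + u_{i+1}` for `i < d`, `A u_d = θ_d u_d`,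
`A* u_{i+1} = c_i u_i + θ*_{i+1} u_{i+1}` for `i < d`, `A* u_0 = θ*_0 u_0`. -/
def IsSplitBasis (Φ : LeonardSystem K 𝒜 d) {V : Type*} [AddCommGroup V] [Module K V]
    [Module 𝒜 V] (u : Module.Basis (Fin (d + 1)) K V) (c : Fin d → K) : Prop :=
  (∀ i : Fin d, Φ.A • u i.castSucc = Φ.eigenvalueSeq i.castSucc • u i.castSucc + u i.succ) ∧
  Φ.A • u (Fin.last d) = Φ.eigenvalueSeq (Fin.last d) • u (Fin.last d) ∧
  (∀ i : Fin d, Φ.Astar • u i.succ =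
    c i • u i.castSucc + Φ.dualEigenvalueSeq i.succ • u i.succ) ∧
  Φ.Astar • u 0 = Φ.dualEigenvalueSeq 0 • u 0

/-- `c` consists of nonzero scalars and belongs to some `Φ`-split basis of `V`. -/
def IsFirstSplitSeq (Φ : LeonardSystem K 𝒜 d) (c : Fin d → K) : Prop :=
  (∀ i, c i ≠ 0) ∧ ∃ u : Module.Basis (Fin (d + 1)) K V, Φ.IsSplitBasis u c

open Classical in
/-- The first split sequence of `Φ`, read off from a simple `𝒜`-module `V`. For such `V` the
sequence of the previous definition exists and is unique, so the default value is never used. -/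
noncomputable def firstSplitSeq (Φ : LeonardSystem K 𝒜 d) : Fin d → K :=
  if h : ∃ c, Φ.IsFirstSplitSeq V c then h.choose else 0

end Split

end LeonardSystem

/-- A quadruple of sequences `({θ_i}_{i=0}^d; {θ*_i}_{i=0}^d; {varphi_i}_{i=1}^d; {phi_i}_{i=1}^d)`.
The sequences are functions on `ℕ`; only the entries in the ranges shown are meaningful. -/
structure ParameterArray (K : Type*) (d : ℕ) where
  theta : ℕ → K
  thetaStar : ℕ → K
  varphi : ℕ → K
  phi : ℕ → K

/-- A finite sequence as a function on `ℕ`, with value `0` past its end. -/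
def natExtend {n : ℕ} (f : Fin n → K) (k : ℕ) : K :=
  if h : k < n then f ⟨k, h⟩ else 0

/-- The parameter array of `Φ`: the eigenvalue sequence, the dual eigenvalue sequence, the first
split sequence, and the second split sequence, which is the first split sequence of `Φ^⇓`.
The split sequences are numbered from `1` to `d`. -/
noncomputable def LeonardSystem.parameterArray (Φ : LeonardSystem K 𝒜 d)
    (V : Type*) [AddCommGroup V] [Module K V] [Module 𝒜 V] : ParameterArray K d where
  theta := natExtend Φ.eigenvalueSeq
  thetaStar := natExtend Φ.dualEigenvalueSeq
  varphi := fun i => natExtend (Φ.firstSplitSeq V) (i - 1)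
  phi := fun i => natExtend (Φ.dDown.firstSplitSeq V) (i - 1)

namespace ParameterArray

/-- `τ_i = (λ - θ_0)(λ - θ_1) ⋯ (λ - θ_{i-1})`. -/
noncomputable def tau (p : ParameterArray K d) (i : ℕ) : K[X] :=
  ∏ k ∈ Finset.range i, (X - C (p.theta k))

/-- `η_i = (λ - θ_d)(λ - θ_{d-1}) ⋯ (λ - θ_{d-i+1})`. -/
noncomputable def eta (p : ParameterArray K d) (i : ℕ) : K[X] :=
  ∏ k ∈ Finset.range i, (X - C (p.theta (d - k)))

/-- `τ*_i = (λ - θ*_0)(λ - θ*_1) ⋯ (λ - θ*_{i-1})`. -/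
noncomputable def tauStar (p : ParameterArray K d) (i : ℕ) : K[X] :=
  ∏ k ∈ Finset.range i, (X - C (p.thetaStar k))

/-- `η*_i = (λ - θ*_d)(λ - θ*_{d-1}) ⋯ (λ - θ*_{d-i+1})`. -/
noncomputable def etaStar (p : ParameterArray K d) (i : ℕ) : K[X] :=
  ∏ k ∈ Finset.range i, (X - C (p.thetaStar (d - k)))

/-- `varphi_1 varphi_2 ⋯ varphi_i`. -/
def varphiUp (p : ParameterArray K d) (i : ℕ) : K := ∏ k ∈ Finset.range i, p.varphi (k + 1)

/-- `varphi_d varphi_{d-1} ⋯ varphi_{d-i+1}`. -/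
def varphiDown (p : ParameterArray K d) (i : ℕ) : K := ∏ k ∈ Finset.range i, p.varphi (d - k)

/-- `phi_1 phi_2 ⋯ phi_i`. -/
def phiUp (p : ParameterArray K d) (i : ℕ) : K := ∏ k ∈ Finset.range i, p.phi (k + 1)

/-- `phi_d phi_{d-1} ⋯ phi_{d-i+1}`. -/
def phiDown (p : ParameterArray K d) (i : ℕ) : K := ∏ k ∈ Finset.range i, p.phi (d - k)

/-- `(θ_0 - θ_1)(θ_0 - θ_2) ⋯ (θ_0 - θ_i)`. -/
def thetaUp (p : ParameterArray K d) (i : ℕ) : K :=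
  ∏ k ∈ Finset.range i, (p.theta 0 - p.theta (k + 1))

/-- `(θ_d - θ_{d-1})(θ_d - θ_{d-2}) ⋯ (θ_d - θ_{d-i})`. -/
def thetaDown (p : ParameterArray K d) (i : ℕ) : K :=
  ∏ k ∈ Finset.range i, (p.theta d - p.theta (d - (k + 1)))

/-- `(θ*_0 - θ*_1)(θ*_0 - θ*_2) ⋯ (θ*_0 - θ*_i)`. -/
def thetaStarUp (p : ParameterArray K d) (i : ℕ) : K :=
  ∏ k ∈ Finset.range i, (p.thetaStar 0 - p.thetaStar (k + 1))

/-- `(θ*_d - θ*_{d-1})(θ*_d - θ*_{d-2}) ⋯ (θ*_d - θ*_{d-i})`. -/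
def thetaStarDown (p : ParameterArray K d) (i : ℕ) : K :=
  ∏ k ∈ Finset.range i, (p.thetaStar d - p.thetaStar (d - (k + 1)))

end ParameterArray

end LeonardSystems

section QNumbers

variable {L : Type*} [Field L]

/-- `[n] = (q^{n/2} - q^{-n/2}) / (q^{1/2} - q^{-1/2})`, in terms of a square root
`w = q^{1/2}` of `q`. -/
def qNumber (w : L) (n : ℕ) : L := (w ^ n - w⁻¹ ^ n) / (w - w⁻¹)

/-- `[n]! = [n][n-1] ⋯ [2][1]`, with `[0]! = 1`. -/
def qFactorial (w : L) (n : ℕ) : L := ∏ k ∈ Finset.range n, qNumber w (k + 1)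

/-- `[r,s,t] = [r+s]! [r+t]! [s+t]! / ([r]! [s]! [t]! [r+s+t]!)`. -/
def qTriple (w : L) (r s t : ℕ) : L :=
  (qFactorial w (r + s) * qFactorial w (r + t) * qFactorial w (s + t)) /
    (qFactorial w r * qFactorial w s * qFactorial w t * qFactorial w (r + s + t))

end QNumbers

/-! ### Expansion of η_i in the τ_h with q-multinomial coefficients. -/

section QIdentities

variable {L : Type*} [Field L]

/-! All eight identities are images of a single polynomial identity under linear functionals. If
distinct θ_0, …, θ_d satisfy the recurrence with parameter β = q + q⁻¹, then θ_i = a + b q^i + c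
q^{-i}, and induction on i gives η_i = ∑_h [h, i-h, d-i] η_{i-h}(θ_0) τ_h
(`prod_rev_eq_sum_qTriple`). Reversing the sequence exchanges τ and η, so each τ_i expands in the
η_h as well.

The functionals are corner entries. Let w and e be eigenbases of A and A* on V. For F(p) = the (0,0)
entry of p(A) with respect to e, F(τ_n) is varphi_1⋯varphi_n divided by (θ*_0-θ*_1)⋯(θ*_0-θ*_n).
Indeed, the split vector u_0 is a multiple of e_0, τ_n(A) carries u_0 to u_n, and the lowering
action of A* determines the e_0-coordinate of u_n. The split basis of Φ^⇓ belongs to the same A and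
A* with the θ_i reversed, so the same F sends η_n to the quotient with phi in place of varphi. The
(d,d) entry of p(A), and the corner entries of p(A*) with respect to w, behave alike. Each of the
four functionals, applied to both expansions, yields two of the identities.

Two facts about Leonard systems are proved on the way. The recurrence comes from writing A²A*A -
AA*A² as a commutator [Q(A), A*] and comparing entries three below the diagonal
(`exists_recurrence`). A split basis is u_j = τ_j(A) e_0, which is triangular with respect to e and
oppositely triangular with respect to w (`exists_split`). Simplicity of V enters by identifying 𝒜
with End V. -/

theorem exists_eq_add_pow_of_recurrence {q : L} (hq0 : q ≠ 0) (hq1 : q ≠ 1) (hq2 : q ≠ -1)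
    {d : ℕ} {θ : ℕ → L}
    (hrec : ∀ i, i + 3 ≤ d → θ i - θ (i + 3) = (q + q⁻¹ + 1) * (θ (i + 1) - θ (i + 2))) :
    ∃ a b c : L, ∀ i ≤ d, θ i = a + b * q ^ i + c * q⁻¹ ^ i := by
  have h1 : q - 1 ≠ 0 := sub_ne_zero.2 hq1
  have h2 : q + 1 ≠ 0 := fun h => hq2 (eq_neg_of_add_eq_zero_left h)
  -- With B = b(q - 1), the first two differences are B + c(q⁻¹ - 1) and qB + q⁻¹c(q⁻¹ - 1).
  -- Eliminating c gives B(q² - 1), so q ≠ ±1 makes the fit to θ_0, θ_1, θ_2 possible.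
  set B := (q * (θ 2 - θ 1) - (θ 1 - θ 0)) / ((q - 1) * (q + 1)) with hB
  set b := B / (q - 1) with hb
  set c := (θ 1 - θ 0 - B) * q / (1 - q) with hc
  have h1' : 1 - q ≠ 0 := sub_ne_zero.2 hq1.symm
  have e0 : θ 0 = (θ 0 - b - c) + b * q ^ 0 + c * q⁻¹ ^ 0 := by ring
  have e1 : θ 1 = (θ 0 - b - c) + b * q ^ 1 + c * q⁻¹ ^ 1 := by
    have hb1 : b * (q - 1) = B := by rw [hb]; field_simp
    have hc1 : c * (q⁻¹ - 1) = θ 1 - θ 0 - B := by rw [hc]; field_simp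
    linear_combination -hb1 - hc1
  have e2 : θ 2 = (θ 0 - b - c) + b * q ^ 2 + c * q⁻¹ ^ 2 := by
    have hb1 : b * (q - 1) = B := by rw [hb]; field_simp
    have hc1 : c * (q⁻¹ - 1) = θ 1 - θ 0 - B := by rw [hc]; field_simp
    have hB1 : B * (q - q⁻¹) = (θ 2 - θ 1) - (θ 1 - θ 0) * q⁻¹ := by
      rw [hB]; field_simp; ring
    linear_combination (-(q + 1)) * hb1 - (q⁻¹ + 1) * hc1 - hB1
  refine ⟨θ 0 - b - c, b, c, fun i => ?_⟩
  induction i using Nat.strong_induction_on with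
  | _ i ih =>
    intro hi
    match i, ih, hi with
    | 0, _, _ => exact e0
    | 1, _, _ => exact e1
    | 2, _, _ => exact e2
    | n + 3, ih, hi =>
      have r := hrec n hi
      have i0 := ih n (by omega) (by omega)
      have i1 := ih (n + 1) (by omega) (by omega)
      have i2 := ih (n + 2) (by omega) (by omega)
      have key : θ (n + 3) = θ n - (q + q⁻¹ + 1) * (θ (n + 1) - θ (n + 2)) := by
        linear_combination -r
      rw [key, i0, i1, i2]
      have hqq : q * q⁻¹ = 1 := mul_inv_cancel₀ hq0
      linear_combination (b * q ^ n * (q - 1) + c * q⁻¹ ^ n * (q⁻¹ - 1)) * hqq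

/-- The bracket equals [k][m-h], while θ_h - θ_m and θ_0 - θ_{m+h} are [m-h] and [m+h] times one
common factor, in which a does not occur. -/
theorem qNumber_mul_sub_mul {w : L} (hw : w ≠ 0) (a b c : L) (k h m : ℕ) {θ : ℕ → L}
    (h0 : θ 0 = a + b * (w ^ 2) ^ 0 + c * (w ^ 2)⁻¹ ^ 0)
    (h1 : θ h = a + b * (w ^ 2) ^ h + c * (w ^ 2)⁻¹ ^ h)
    (h2 : θ m = a + b * (w ^ 2) ^ m + c * (w ^ 2)⁻¹ ^ m)
    (h3 : θ (m + h) = a + b * (w ^ 2) ^ (m + h) + c * (w ^ 2)⁻¹ ^ (m + h)) :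
    (qNumber w (k + h) * qNumber w m - qNumber w (k + m) * qNumber w h) * (θ 0 - θ (m + h)) =
      (θ h - θ m) * (qNumber w (m + h) * qNumber w k) := by
  rw [h0, h1, h2, h3]
  have e : ∀ n, (w ^ 2) ^ n = (w ^ n) ^ 2 := fun n => by ring
  simp only [qNumber, inv_pow, e, pow_add, pow_zero]
  have hk : w ^ k ≠ 0 := pow_ne_zero _ hw
  have hh : w ^ h ≠ 0 := pow_ne_zero _ hw
  have hm : w ^ m ≠ 0 := pow_ne_zero _ hw
  generalize w ^ k = x at *
  generalize w ^ h = y at *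
  generalize w ^ m = z at *
  generalize w - w⁻¹ = D
  rcases eq_or_ne D 0 with rfl | hD
  -- If w = w⁻¹, every q-number is a division by 0, and both sides vanish.
  · simp
  · field_simp
    ring

theorem qFactorial_succ (w : L) (n : ℕ) :
    qFactorial w (n + 1) = qFactorial w n * qNumber w (n + 1) :=
  Finset.prod_range_succ _ _

theorem qFactorial_ne_zero {w : L} {d : ℕ} (h : ∀ n, 1 ≤ n → n ≤ d → qNumber w n ≠ 0) {n : ℕ}
    (hn : n ≤ d) : qFactorial w n ≠ 0 :=
  Finset.prod_ne_zero_iff.2 fun k hk => h _ (by omega) (by have := Finset.mem_range.1 hk; omega)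

theorem qTriple_zero_left {w : L} {s t : ℕ} (h : ∀ n ≤ s + t, qFactorial w n ≠ 0) :
    qTriple w 0 s t = 1 := by
  have := h s (by omega)
  have := h t (by omega)
  have := h (s + t) le_rfl
  have : qFactorial w 0 ≠ 0 := h 0 (by omega)
  simp only [qTriple, Nat.zero_add]
  have h0 : qFactorial w 0 = 1 := rfl
  rw [h0]
  field_simp

theorem qTriple_zero_mid {w : L} {r t : ℕ} (h : ∀ n ≤ r + t, qFactorial w n ≠ 0) :
    qTriple w r 0 t = 1 := by
  have := h r (by omega)
  have := h t (by omega)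
  have := h (r + t) le_rfl
  simp only [qTriple, Nat.zero_add, Nat.add_zero]
  have h0 : qFactorial w 0 = 1 := rfl
  rw [h0]
  field_simp

/-- The recurrence behind the expansion of `η_{i+1}` in the `τ_h`, at `h + 1 = r + 1`. -/
theorem qTriple_recurrence {w : L} (hw : w ≠ 0) {a b c : L} {d r s t : ℕ} {θ : ℕ → L}
    (hd : r + s + t + 2 = d) (hθ : ∀ i ≤ d, θ i = a + b * (w ^ 2) ^ i + c * (w ^ 2)⁻¹ ^ i)
    (hn : ∀ n, 1 ≤ n → n ≤ d → qNumber w n ≠ 0) :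
    qTriple w (r + 1) (s + 1) t * (θ 0 - θ (t + r + 2)) =
      qTriple w r (s + 1) (t + 1) * (θ 0 - θ (t + r + 2)) +
        (θ (r + 1) - θ (t + 1)) * qTriple w (r + 1) s (t + 1) := by
  -- Multiplying the claim by [r+1]! [s+1]! [t+1]! [d]! and removing the common factor [r+s+1]!
  -- [r+t+1]! [s+t+1]! leaves exactly this identity.
  have key := qNumber_mul_sub_mul hw a b c (s + 1) (r + 1) (t + 1) (hθ 0 (by omega))
    (hθ (r + 1) (by omega)) (hθ (t + 1) (by omega)) (hθ (t + 1 + (r + 1)) (by omega))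
  have f : ∀ n ≤ d, qFactorial w n ≠ 0 := fun n h => qFactorial_ne_zero hn h
  have e1 : r + 1 + (s + 1) + t = d := by omega
  have e2 : r + (s + 1) + (t + 1) = d := by omega
  have e3 : r + 1 + s + (t + 1) = d := by omega
  have e4 : t + 1 + (r + 1) = r + t + 1 + 1 := by omega
  have e5 : t + r + 2 = r + t + 1 + 1 := by omega
  have e6 : s + 1 + (t + 1) = s + t + 1 + 1 := by omega
  have e7 : s + 1 + (r + 1) = r + s + 1 + 1 := by omega
  rw [e4, e6, e7] at key
  simp only [qTriple, e1, e2, e3, e5]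
  have a1 : r + 1 + (s + 1) = r + s + 1 + 1 := by omega
  have a2 : r + 1 + t = r + t + 1 := by omega
  have a3 : s + 1 + t = s + t + 1 := by omega
  have a4 : r + (s + 1) = r + s + 1 := by omega
  have a5 : r + (t + 1) = r + t + 1 := by omega
  have a6 : s + 1 + (t + 1) = s + t + 1 + 1 := by omega
  have a7 : r + 1 + s = r + s + 1 := by omega
  have a8 : r + 1 + (t + 1) = r + t + 1 + 1 := by omega
  have a9 : s + (t + 1) = s + t + 1 := by omega
  simp only [a1, a2, a3, a4, a5, a6, a7, a8, a9]
  have g0 := f d le_rfl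
  have g1 := f (r + 1) (by omega)
  have g2 := f (s + 1) (by omega)
  have g3 := f (t + 1) (by omega)
  have g4 := f r (by omega)
  have g5 := f s (by omega)
  have g6 := f t (by omega)
  simp only [qFactorial_succ w (r + s + 1), qFactorial_succ w (r + t + 1),
    qFactorial_succ w (s + t + 1), qFactorial_succ w r, qFactorial_succ w s,
    qFactorial_succ w t] at *
  generalize qFactorial w (r + s + 1) = x1 at *
  generalize qFactorial w (r + t + 1) = x2 at *
  generalize qFactorial w (s + t + 1) = x3 at *
  have k1 := right_ne_zero_of_mul g1
  have k2 := right_ne_zero_of_mul g2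
  have k3 := right_ne_zero_of_mul g3
  field_simp
  linear_combination x1 * x2 * x3 * key

/-- `η_i` expanded in the polynomials `τ_h`. -/
theorem prod_rev_eq_sum_qTriple {w : L} (hw : w ≠ 0) {a b c : L} {d : ℕ} {θ : ℕ → L}
    (hθ : ∀ i ≤ d, θ i = a + b * (w ^ 2) ^ i + c * (w ^ 2)⁻¹ ^ i)
    (hn : ∀ n, 1 ≤ n → n ≤ d → qNumber w n ≠ 0) (i : ℕ) (hi : i ≤ d) :
    ∏ k ∈ Finset.range i, (X - C (θ (d - k))) =
      ∑ h ∈ Finset.range (i + 1),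
        C (qTriple w h (i - h) (d - i) * ∏ k ∈ Finset.range (i - h), (θ 0 - θ (d - k))) *
          ∏ k ∈ Finset.range h, (X - C (θ k)) := by
  have f : ∀ n ≤ d, qFactorial w n ≠ 0 := fun n h => qFactorial_ne_zero hn h
  induction i with
  | zero =>
    simp [qTriple_zero_left (w := w) (s := 0) (t := d) (fun n hn => f n (by omega))]
  | succ i ih =>
    obtain ⟨t, rfl⟩ : ∃ t, d = i + t + 1 := ⟨d - i - 1, by omega⟩
    set d := i + t + 1 with hd
    rw [Finset.prod_range_succ, ih (by omega), Finset.sum_mul]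
    have e1 : d - i = t + 1 := by omega
    have e2 : d - (i + 1) = t := by omega
    rw [e1, e2]
    set τ : ℕ → L[X] := fun h => ∏ k ∈ Finset.range h, (X - C (θ k)) with hτ
    set P : ℕ → L := fun h => ∏ k ∈ Finset.range h, (θ 0 - θ (d - k)) with hP
    have hstep : ∀ h, τ (h + 1) = τ h * (X - C (θ h)) := fun h => Finset.prod_range_succ _ _
    have hPs : ∀ h, P (h + 1) = P h * (θ 0 - θ (d - h)) := fun h => Finset.prod_range_succ _ _
    -- The new factor is X - θ_{d-i} with d - i = t + 1; writing it as (X - θ_h) + (θ_h - θ_{t+1})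
    -- turns τ_h into τ_{h+1} plus a multiple of τ_h.
    have hsplit : ∀ h ∈ Finset.range (i + 1),
        C (qTriple w h (i - h) (t + 1) * P (i - h)) * τ h * (X - C (θ (t + 1))) =
        C (qTriple w h (i - h) (t + 1) * P (i - h)) * τ (h + 1) +
          C (qTriple w h (i - h) (t + 1) * P (i - h) * (θ h - θ (t + 1))) * τ h := by
      intro h _
      rw [hstep]
      simp only [map_mul, map_sub]
      ring
    -- The extreme terms τ_{i+1} and τ_0 are split off, since only one of the two sums contributes
    -- to each; for the others both contribute and the three-term recurrence applies.
    rw [Finset.sum_congr rfl hsplit, Finset.sum_add_distrib, Finset.sum_range_succ,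
      Finset.sum_range_succ' (fun h => C (qTriple w h (i - h) (t + 1) * P (i - h) *
        (θ h - θ (t + 1))) * τ h), Finset.sum_range_succ _ (i + 1), Finset.sum_range_succ']
    have htop : qTriple w i (i - i) (t + 1) * P (i - i) =
        qTriple w (i + 1) (i + 1 - (i + 1)) t * P (i + 1 - (i + 1)) := by
      rw [Nat.sub_self, Nat.sub_self, qTriple_zero_mid fun n hn => f n (by omega),
        qTriple_zero_mid fun n hn => f n (by omega)]
    have hbot : qTriple w 0 (i - 0) (t + 1) * P (i - 0) * (θ 0 - θ (t + 1)) =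
        qTriple w 0 (i + 1 - 0) t * P (i + 1 - 0) := by
      rw [Nat.sub_zero, Nat.sub_zero, qTriple_zero_left fun n hn => f n (by omega),
        qTriple_zero_left fun n hn => f n (by omega), hPs, e1]
      ring
    have hmid : ∀ h ∈ Finset.range i,
        C (qTriple w (h + 1) (i + 1 - (h + 1)) t * P (i + 1 - (h + 1))) * τ (h + 1) =
        C (qTriple w h (i - h) (t + 1) * P (i - h)) * τ (h + 1) +
          C (qTriple w (h + 1) (i - (h + 1)) (t + 1) * P (i - (h + 1)) *
            (θ (h + 1) - θ (t + 1))) * τ (h + 1) := by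
      intro h hh
      have hh := Finset.mem_range.1 hh
      obtain ⟨s, rfl⟩ : ∃ s, i = h + s + 1 := ⟨i - h - 1, by omega⟩
      have a1 : h + s + 1 + 1 - (h + 1) = s + 1 := by omega
      have a2 : h + s + 1 - h = s + 1 := by omega
      have a3 : h + s + 1 - (h + 1) = s := by omega
      have a4 : d - s = t + h + 2 := by omega
      rw [a1, a2, a3, hPs, a4, ← add_mul, ← C_add]
      congr 2
      have := qTriple_recurrence hw (r := h) (s := s) (t := t) (by omega) hθ hn
      linear_combination P s * this
    rw [Finset.sum_congr rfl hmid, Finset.sum_add_distrib, htop, hbot]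
    ring

/-- If [n] = 0 then q^n = 1, which would give θ_n = θ_0. -/
theorem qNumber_ne_zero_of_injOn {w : L} (hw : w ≠ 0) (hw1 : w ^ 2 ≠ 1) {a b c : L} {d : ℕ}
    {θ : ℕ → L} (hθ : ∀ i ≤ d, θ i = a + b * (w ^ 2) ^ i + c * (w ^ 2)⁻¹ ^ i)
    (hinj : ∀ i j, i ≤ d → j ≤ d → θ i = θ j → i = j) (n : ℕ) (h1 : 1 ≤ n) (hn : n ≤ d) :
    qNumber w n ≠ 0 := by
  have hD : w - w⁻¹ ≠ 0 := by
    intro h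
    apply hw1
    have := mul_inv_cancel₀ hw
    linear_combination w * h + this
  refine div_ne_zero (fun h => ?_) hD
  have hq : (w ^ 2) ^ n = 1 := by
    have h3 : w ^ n * w⁻¹ ^ n = 1 := by rw [← mul_pow, mul_inv_cancel₀ hw, one_pow]
    have : (w ^ 2) ^ n = w ^ n * w ^ n := by ring
    rw [this]
    linear_combination w ^ n * h + h3
  have : n = 0 := hinj n 0 hn (by omega) (by rw [hθ n hn, hθ 0 (by omega), inv_pow, hq]; simp)
  omega

/-- The expansion of `η_i` in the `τ_h` for mutually distinct `θ_0, …, θ_d` satisfying the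
three-term recurrence with parameter `β = q + q⁻¹`, where `q = w ^ 2`. -/
theorem prod_rev_eq_sum_qTriple_of_recurrence {w : L} (hw : w ≠ 0) (hq1 : w ^ 2 ≠ 1)
    (hq2 : w ^ 2 ≠ -1) {d : ℕ} {θ : ℕ → L}
    (hrec : ∀ i, i + 3 ≤ d →
      θ i - θ (i + 3) = (w ^ 2 + (w ^ 2)⁻¹ + 1) * (θ (i + 1) - θ (i + 2)))
    (hinj : ∀ i j, i ≤ d → j ≤ d → θ i = θ j → i = j) (i : ℕ) (hi : i ≤ d) :
    ∏ k ∈ Finset.range i, (X - C (θ (d - k))) =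
      ∑ h ∈ Finset.range (i + 1),
        C (qTriple w h (i - h) (d - i) * ∏ k ∈ Finset.range (i - h), (θ 0 - θ (d - k))) *
          ∏ k ∈ Finset.range h, (X - C (θ k)) := by
  obtain ⟨a, b, c, h⟩ := exists_eq_add_pow_of_recurrence (pow_ne_zero 2 hw) hq1 hq2 hrec
  exact prod_rev_eq_sum_qTriple hw h (qNumber_ne_zero_of_injOn hw hq1 h hinj) i hi

/-- A linear functional on `K[X]` applied to the expansion of `η_i` in the `τ_h`. -/
theorem algebraMap_apply_prod_rev {K : Type*} [Field K] [Algebra K L] {w : L} (hw : w ≠ 0)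
    (hq1 : w ^ 2 ≠ 1) (hq2 : w ^ 2 ≠ -1) {d : ℕ} {θ : ℕ → K} {β : K}
    (hβ : algebraMap K L β = w ^ 2 + (w ^ 2)⁻¹)
    (hrec : ∀ i, i + 3 ≤ d → θ i - θ (i + 3) = (β + 1) * (θ (i + 1) - θ (i + 2)))
    (hinj : ∀ i j, i ≤ d → j ≤ d → θ i = θ j → i = j) (F : K[X] →ₗ[K] K) (i : ℕ) (hi : i ≤ d) :
    algebraMap K L (F (∏ k ∈ Finset.range i, (X - C (θ (d - k))))) =
      ∑ h ∈ Finset.range (i + 1), qTriple w h (i - h) (d - i) *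
        algebraMap K L ((∏ k ∈ Finset.range (i - h), (θ 0 - θ (d - k))) *
          F (∏ k ∈ Finset.range h, (X - C (θ k)))) := by
  -- The coefficients of the expansion lie in L, not in K, so F is first extended L-linearly through
  -- its values on monomials.
  let G : L[X] →ₗ[L] L :=
    (Polynomial.basisMonomials L).constr L fun n => algebraMap K L (F (X ^ n))
  have hG : ∀ f : K[X], G (f.map (algebraMap K L)) = algebraMap K L (F f) := by
    intro f
    induction f using Polynomial.induction_on' with
    | add f g hf hg => simp [hf, hg]
    | monomial n x =>
      have h1 : G (monomial n 1) = algebraMap K L (F (X ^ n)) := by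
        have := (Polynomial.basisMonomials L).constr_basis L
          (fun n => algebraMap K L (F (X ^ n))) n
        simpa using this
      have h2 : (monomial n (algebraMap K L x)) = algebraMap K L x • (monomial n (1 : L)) := by
        rw [smul_monomial, smul_eq_mul, mul_one]
      have h3 : (monomial n x) = x • (X ^ n : K[X]) := by
        rw [← monomial_one_right_eq_X_pow, smul_monomial, smul_eq_mul, mul_one]
      rw [map_monomial, h2, map_smul, h1, h3, map_smul]
      simp
  have key := prod_rev_eq_sum_qTriple_of_recurrence (θ := fun k => algebraMap K L (θ k))
    hw hq1 hq2 (d := d) (fun i hi => by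
      have := congrArg (algebraMap K L) (hrec i hi)
      simpa [hβ] using this)
    (fun i j hi hj h => hinj i j hi hj ((algebraMap K L).injective h)) i hi
  have hmap : ∀ (s : Finset ℕ) (g : ℕ → K), (∏ k ∈ s, (X - C (g k))).map (algebraMap K L) =
      ∏ k ∈ s, (X - C (algebraMap K L (g k))) := fun s g => by
    rw [Polynomial.map_prod]; simp
  rw [← hG, hmap, key, map_sum]
  refine Finset.sum_congr rfl fun h _ => ?_
  rw [← hmap, ← smul_eq_C_mul, map_smul, hG]
  simp [mul_assoc]

end QIdentities

/-! ### Powers of irreducible tridiagonal matrices. -/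

section BandedMatrices

variable {K : Type*} [Field K] {d : ℕ}

/-- `M` is tridiagonal with nonzero entries next to the diagonal. -/
def IsIrredTridiagonal (M : Matrix (Fin (d + 1)) (Fin (d + 1)) K) : Prop :=
  (∀ i j : Fin (d + 1), 1 < |((i : ℕ) : ℤ) - ((j : ℕ) : ℤ)| → M i j = 0) ∧
  ∀ i j : Fin (d + 1), |((i : ℕ) : ℤ) - ((j : ℕ) : ℤ)| = 1 → M i j ≠ 0

namespace IsIrredTridiagonal

variable {M : Matrix (Fin (d + 1)) (Fin (d + 1)) K} (hM : IsIrredTridiagonal M)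
include hM

theorem eq_zero_of_lt {i j : Fin (d + 1)} (h : (j : ℕ) + 1 < i) : M i j = 0 :=
  hM.1 i j (by rw [lt_abs]; omega)

theorem eq_zero_of_gt {i j : Fin (d + 1)} (h : (i : ℕ) + 1 < j) : M i j = 0 :=
  hM.1 i j (by rw [lt_abs]; omega)

theorem ne_zero_of_succ {i j : Fin (d + 1)} (h : (i : ℕ) = j + 1) : M i j ≠ 0 :=
  hM.2 i j (by rw [h]; simp)

theorem ne_zero_of_pred {i j : Fin (d + 1)} (h : (j : ℕ) = i + 1) : M i j ≠ 0 :=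
  hM.2 i j (by rw [h]; simp)

theorem pow_apply_eq_zero (n : ℕ) : ∀ {i j : Fin (d + 1)}, (j : ℕ) + n < i → (M ^ n) i j = 0 := by
  induction n with
  | zero => exact fun h => Matrix.one_apply_ne (by rintro rfl; omega)
  | succ n ih =>
    intro i j h
    rw [pow_succ', Matrix.mul_apply]
    refine Finset.sum_eq_zero fun k _ => ?_
    by_cases hk : (j : ℕ) + n < k
    · rw [ih hk, mul_zero]
    · rw [hM.eq_zero_of_lt (by omega), zero_mul]

theorem pow_succ_apply (n : ℕ) {i j k : Fin (d + 1)} (hi : (i : ℕ) = k + 1)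
    (hk : (k : ℕ) = j + n) : (M ^ (n + 1)) i j = M i k * (M ^ n) k j := by
  rw [pow_succ', Matrix.mul_apply]
  refine Finset.sum_eq_single k (fun l _ hl => ?_) (by simp)
  have : (l : ℕ) ≠ k := fun h => hl (Fin.ext h)
  by_cases h : (j : ℕ) + n < l
  · rw [hM.pow_apply_eq_zero n h, mul_zero]
  · rw [hM.eq_zero_of_lt (by omega), zero_mul]

/-- Only one path descends n rows in n steps, so the entry is a product of subdiagonal entries. -/
theorem pow_apply_ne_zero (n : ℕ) : ∀ {i j : Fin (d + 1)}, (i : ℕ) = j + n → (M ^ n) i j ≠ 0 := by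
  induction n with
  | zero =>
    intro i j h
    obtain rfl : i = j := Fin.ext h
    simp
  | succ n ih =>
    intro i j h
    have hk : (j : ℕ) + n < d + 1 := by omega
    rw [hM.pow_succ_apply n (k := ⟨j + n, hk⟩) (by simpa [add_assoc] using h) rfl]
    exact mul_ne_zero (hM.ne_zero_of_succ (by simp; omega)) (ih rfl)

theorem aeval_apply_eq_zero {p : K[X]} {n : ℕ} (hp : p.natDegree ≤ n) {i j : Fin (d + 1)}
    (h : (j : ℕ) + n < i) : (aeval M p) i j = 0 := by
  rw [aeval_eq_sum_range' (Nat.lt_succ_of_le hp), Matrix.sum_apply]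
  refine Finset.sum_eq_zero fun k hk => ?_
  have := Finset.mem_range.1 hk
  rw [Matrix.smul_apply, hM.pow_apply_eq_zero k (by omega), smul_zero]

/-- On the n-th subdiagonal the powers below n vanish, so only the coefficient of degree n is
visible. -/
theorem aeval_apply_eq {p : K[X]} {n : ℕ} (hp : p.natDegree ≤ n) {i j : Fin (d + 1)}
    (h : (i : ℕ) = j + n) : (aeval M p) i j = p.coeff n * (M ^ n) i j := by
  rw [aeval_eq_sum_range' (Nat.lt_succ_of_le hp), Matrix.sum_apply,
    Finset.sum_eq_single_of_mem n (by simp)]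
  · rw [Matrix.smul_apply, smul_eq_mul]
  · intro k hk hkn
    have := Finset.mem_range.1 hk
    rw [Matrix.smul_apply, hM.pow_apply_eq_zero k (by omega), smul_zero]

/-- Entries of `M ^ r * D * M ^ s` on the diagonal `r + s` below the main one. -/
theorem pow_mul_diagonal_mul_pow_apply_eq_zero (D : Fin (d + 1) → K) (r s : ℕ)
    {i j : Fin (d + 1)} (h : (j : ℕ) + (r + s) < i) :
    (M ^ r * Matrix.diagonal D * M ^ s) i j = 0 := by
  rw [Matrix.mul_apply]
  refine Finset.sum_eq_zero fun k _ => ?_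
  rw [Matrix.mul_diagonal]
  by_cases hk : (j : ℕ) + s < k
  · rw [hM.pow_apply_eq_zero s hk, mul_zero]
  · rw [hM.pow_apply_eq_zero r (by omega), zero_mul, zero_mul]

theorem pow_mul_diagonal_mul_pow_apply (D : Fin (d + 1) → K) (r s : ℕ)
    {i j k : Fin (d + 1)} (hi : (i : ℕ) = k + r) (hk : (k : ℕ) = j + s) :
    (M ^ r * Matrix.diagonal D * M ^ s) i j = D k * (M ^ (r + s)) i j := by
  have key : ∀ D : Fin (d + 1) → K, (M ^ r * Matrix.diagonal D * M ^ s) i j =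
      D k * ((M ^ r) i k * (M ^ s) k j) := by
    intro D
    rw [Matrix.mul_apply, Finset.sum_eq_single k]
    · rw [Matrix.mul_diagonal]; ring
    · intro l _ hl
      have : (l : ℕ) ≠ k := fun h => hl (Fin.ext h)
      rw [Matrix.mul_diagonal]
      by_cases h : (j : ℕ) + s < l
      · rw [hM.pow_apply_eq_zero s h, mul_zero]
      · rw [hM.pow_apply_eq_zero r (by omega), zero_mul, zero_mul]
    · simp
  -- The case where the diagonal matrix is the identity identifies the remaining product with an
  -- entry of the power r + s.
  have h1 := key fun _ => 1
  rw [Matrix.diagonal_one, mul_one, ← pow_add, one_mul] at h1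
  rw [key, h1]

end IsIrredTridiagonal

end BandedMatrices

/-! ### Triangular changes of basis. -/

section TriangularBasisChange

open Module

variable {K V ι α : Type*} [Field K] [AddCommGroup V] [Module K V] [Fintype ι] [DecidableEq ι]
  [LinearOrder α] {s : ι → α}

/-- The order map `s` allows both shapes: `id` gives upper and `OrderDual.toDual` lower triangular
matrices. -/
theorem blockTriangular_toMatrix_flip (u f : Basis ι K V)
    (h : Matrix.BlockTriangular (f.toMatrix u) s) :
    Matrix.BlockTriangular (u.toMatrix f) s := by
  have h1 : f.toMatrix u * u.toMatrix f = 1 := Basis.toMatrix_mul_toMatrix_flip f u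
  have h2 : u.toMatrix f * f.toMatrix u = 1 := Basis.toMatrix_mul_toMatrix_flip u f
  let _ : Invertible (f.toMatrix u) := ⟨u.toMatrix f, h2, h1⟩
  have := Matrix.blockTriangular_inv_of_blockTriangular h
  rwa [Matrix.inv_eq_right_inv h1] at this

theorem toMatrix_flip_mul_diag (hs : Function.Injective s) (u f : Basis ι K V)
    (h : Matrix.BlockTriangular (f.toMatrix u) s) (i : ι) :
    u.toMatrix f i i * f.toMatrix u i i = 1 := by
  have h2 : (u.toMatrix f * f.toMatrix u) i i = 1 := by
    rw [Basis.toMatrix_mul_toMatrix_flip, Matrix.one_apply_eq]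
  rw [Matrix.mul_apply, Finset.sum_eq_single i] at h2
  · exact h2
  · intro k _ hk
    rcases lt_or_gt_of_ne fun e => hk (hs e) with hlt | hgt
    · rw [blockTriangular_toMatrix_flip u f h hlt, zero_mul]
    · rw [h hgt, mul_zero]
  · simp

end TriangularBasisChange

/-! ### Leonard pairs in eigenbases: the recurrence and the split basis. -/

section LeonardBases

open Module

variable {K V : Type*} [Field K] [AddCommGroup V] [Module K V] {d : ℕ}

theorem natExtend_of_lt {n : ℕ} (f : Fin n → K) {k : ℕ} (h : k < n) :
    natExtend f k = f ⟨k, h⟩ :=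
  dif_pos h

theorem natExtend_val {n : ℕ} (f : Fin n → K) (i : Fin n) : natExtend f i = f i :=
  natExtend_of_lt f i.2

theorem Module.Basis.apply_eq_sum_repr_mul {ι : Type*} [Fintype ι] (w : Basis ι K V)
    (f : V →ₗ[K] K) (x : V) : f x = ∑ i, w.repr x i * f (w i) := by
  conv_lhs => rw [← w.sum_repr x]
  simp only [map_sum, map_smul, smul_eq_mul]

theorem repr_apply_of_eigenbasis {ι : Type*} {a : End K V} {w : Basis ι K V} {θ : ι → K}
    (h : ∀ i, a (w i) = θ i • w i) (x : V) (i : ι) : w.repr (a x) i = θ i * w.repr x i := by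
  have : w.coord i ∘ₗ a = θ i • w.coord i := w.ext fun j => by
    rcases eq_or_ne j i with rfl | hj
    · simp [h]
    · simp [h, hj]
  exact LinearMap.congr_fun this x

theorem aeval_apply_of_eigenbasis {ι : Type*} {a : End K V} {w : Basis ι K V} {θ : ι → K}
    (h : ∀ i, a (w i) = θ i • w i) (p : K[X]) (i : ι) : aeval a p (w i) = p.eval (θ i) • w i := by
  induction p using Polynomial.induction_on' with
  | add p q hp hq => simp [hp, hq, add_smul]
  | monomial n c =>
    have : (a ^ n) (w i) = θ i ^ n • w i := by
      induction n with
      | zero => simp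
      | succ n ih => rw [pow_succ', Module.End.mul_apply, ih, map_smul, h, smul_smul, pow_succ]
    rw [aeval_monomial, Module.End.mul_apply, this]
    simp [smul_smul, mul_comm]

/-- Eigenbases `w` of `a` and `e` of `b`, with mutually distinct eigenvalues, such that each of the
two maps is irreducible tridiagonal with respect to the eigenbasis of the other. -/
structure IsLeonardBases (a b : End K V) (w e : Basis (Fin (d + 1)) K V)
    (θ θs : Fin (d + 1) → K) : Prop where
  inj : Function.Injective θ
  inj_star : Function.Injective θs
  eig : ∀ i, a (w i) = θ i • w i
  eig_star : ∀ i, b (e i) = θs i • e i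
  tri : IsIrredTridiagonal (LinearMap.toMatrixAlgEquiv e a)
  tri_star : IsIrredTridiagonal (LinearMap.toMatrixAlgEquiv w b)

namespace IsLeonardBases

variable {a b : End K V} {w e : Basis (Fin (d + 1)) K V} {θ θs : Fin (d + 1) → K}
  (H : IsLeonardBases a b w e θ θs)
include H

/-- `A²A*A - AA*A²` is the commutator of a polynomial in `A` with `A*`. -/
theorem exists_commutator : ∃ Q : K[X], Q.natDegree ≤ d ∧
    (∀ i j : Fin (d + 1), (i : ℕ) = j + 1 →
      Q.eval (θ i) - Q.eval (θ j) = θ i * θ j * (θ i - θ j)) ∧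
    a ^ 2 * b * a - a * b * a ^ 2 = aeval a Q * b - b * aeval a Q := by
  set t : ℕ → K := natExtend θ with ht
  have htθ : ∀ i : Fin (d + 1), t i = θ i := natExtend_val θ
  -- Partial sums, so that interpolation gives Q the prescribed increments between consecutive
  -- eigenvalues.
  set z : Fin (d + 1) → K := fun i =>
    ∑ k ∈ Finset.range i, t (k + 1) * t k * (t (k + 1) - t k) with hz
  set Q := Lagrange.interpolate Finset.univ θ z with hQ
  have hQz : ∀ i, Q.eval (θ i) = z i := fun i =>
    Lagrange.eval_interpolate_at_node z H.inj.injOn (Finset.mem_univ i)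
  have hstep : ∀ i j : Fin (d + 1), (i : ℕ) = j + 1 →
      Q.eval (θ i) - Q.eval (θ j) = θ i * θ j * (θ i - θ j) := by
    intro i j h
    rw [hQz, hQz, hz]
    simp only [h, Finset.sum_range_succ, add_sub_cancel_left]
    rw [← h, htθ, htθ]
  refine ⟨Q, ?_, hstep, ?_⟩
  · have := Lagrange.degree_interpolate_lt z (H.inj.injOn (s := (Finset.univ : Finset (Fin (d+1)))))
    rw [Finset.card_univ, Fintype.card_fin] at this
    exact natDegree_le_iff_coeff_eq_zero.2 fun N hN => coeff_eq_zero_of_degree_lt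
      (lt_of_lt_of_le this (by exact_mod_cast hN))
  -- In the basis w the (i, j) entries are those of b times θ_iθ_j(θ_i - θ_j) and Q(θ_i) - Q(θ_j).
  -- As b is tridiagonal, only consecutive i, j matter.
  · refine w.ext fun j => w.ext_elem fun i => ?_
    have hr := repr_apply_of_eigenbasis H.eig
    have hp : ∀ x i, w.repr (aeval a Q x) i = Q.eval (θ i) * w.repr x i := fun x i =>
      repr_apply_of_eigenbasis (aeval_apply_of_eigenbasis H.eig Q) x i
    simp only [LinearMap.sub_apply, Module.End.mul_apply, pow_two, map_sub, Finsupp.sub_apply,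
      hr, hp, H.eig, aeval_apply_of_eigenbasis H.eig, map_smul, Finsupp.smul_apply, smul_eq_mul]
    have hB : w.repr (b (w j)) i = LinearMap.toMatrixAlgEquiv w b i j := by
      rw [LinearMap.toMatrixAlgEquiv_apply]
    rw [hB]
    generalize hN : LinearMap.toMatrixAlgEquiv w b i j = N
    rcases lt_trichotomy (i : ℕ) j with h | h | h
    · rcases Nat.lt_or_ge (i + 1) j with h' | h'
      · rw [← hN, H.tri_star.eq_zero_of_gt h']; ring
      · have := hstep j i (by omega)
        linear_combination N * this
    · obtain rfl : i = j := Fin.ext h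
      ring
    · rcases Nat.lt_or_ge (j + 1) i with h' | h'
      · rw [← hN, H.tri_star.eq_zero_of_lt h']; ring
      · have := hstep i j (by omega)
        linear_combination -N * this

theorem toMatrixAlgEquiv_star : LinearMap.toMatrixAlgEquiv e b = Matrix.diagonal θs := by
  ext i j
  rw [LinearMap.toMatrixAlgEquiv_apply, H.eig_star, map_smul, Finsupp.smul_apply,
    Basis.repr_self, smul_eq_mul]
  rcases eq_or_ne i j with rfl | h
  · simp
  · simp [h]

/-- The quotients `(θ_i - θ_{i+3}) / (θ_{i+1} - θ_{i+2})` and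
`(θ*_i - θ*_{i+3}) / (θ*_{i+1} - θ*_{i+2})` are all equal. -/
theorem exists_recurrence : ∃ κ : K, ∀ i₀ i₁ i₂ i₃ : Fin (d + 1),
    (i₁ : ℕ) = i₀ + 1 → (i₂ : ℕ) = i₀ + 2 → (i₃ : ℕ) = i₀ + 3 →
    κ * (θ i₀ - θ i₃) = θ i₁ - θ i₂ ∧ κ * (θs i₀ - θs i₃) = θs i₁ - θs i₂ := by
  obtain ⟨Q, hQd, hQ, hcomm⟩ := H.exists_commutator
  set M := LinearMap.toMatrixAlgEquiv e a with hM
  have hc : M ^ 2 * Matrix.diagonal θs * M ^ 1 - M ^ 1 * Matrix.diagonal θs * M ^ 2 =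
      aeval M Q * Matrix.diagonal θs - Matrix.diagonal θs * aeval M Q := by
    have := congrArg (LinearMap.toMatrixAlgEquiv e) hcomm
    have hae : LinearMap.toMatrixAlgEquiv e (aeval a Q) = aeval M Q :=
      (aeval_algHom_apply (LinearMap.toMatrixAlgEquiv e).toAlgHom a Q).symm
    simpa only [map_sub, map_mul, map_pow, H.toMatrixAlgEquiv_star, hae, pow_one] using this
  have hent : ∀ i j, (M ^ 2 * Matrix.diagonal θs * M ^ 1) i j -
      (M ^ 1 * Matrix.diagonal θs * M ^ 2) i j = (aeval M Q) i j * (θs j - θs i) := by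
    intro i j
    have := congrFun (congrFun hc i) j
    rw [Matrix.sub_apply, Matrix.sub_apply, Matrix.mul_diagonal, Matrix.diagonal_mul] at this
    rw [this]; ring
  -- If n = deg Q > 3, the (n, 0) entry is 0 on the left, while on the right it is the leading
  -- coefficient times a nonzero entry of M^n times θ*_0 - θ*_n.
  have hdeg : Q.natDegree ≤ 3 := by
    by_contra! h
    have ht : Q.natDegree < d + 1 := by omega
    have h0 := hent ⟨Q.natDegree, ht⟩ 0
    rw [H.tri.pow_mul_diagonal_mul_pow_apply_eq_zero θs 2 1 (by simpa using h),
      H.tri.pow_mul_diagonal_mul_pow_apply_eq_zero θs 1 2 (by simpa using h), sub_zero,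
      H.tri.aeval_apply_eq le_rfl (by simp)] at h0
    have h1 := H.tri.pow_apply_ne_zero Q.natDegree (i := ⟨Q.natDegree, ht⟩) (j := 0) (by simp)
    have h2 : Q.coeff Q.natDegree ≠ 0 := by
      rw [coeff_natDegree, leadingCoeff_ne_zero]
      rintro rfl
      simp at h
    have h3 : θs 0 - θs ⟨Q.natDegree, ht⟩ ≠ 0 :=
      sub_ne_zero.2 fun h' => by
        have := congrArg Fin.val (H.inj_star h')
        simp at this
        omega
    exact mul_ne_zero (mul_ne_zero h2 h1) h3 h0.symm
  have hev : ∀ x, Q.eval x = Q.coeff 0 + Q.coeff 1 * x + Q.coeff 2 * x ^ 2 + Q.coeff 3 * x ^ 3 := by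
    intro x
    rw [eval_eq_sum_range' (Nat.lt_succ_of_le hdeg)]
    simp [Finset.sum_range_succ]
  refine ⟨Q.coeff 3, fun i₀ i₁ i₂ i₃ h1 h2 h3 => ⟨?_, ?_⟩⟩
  -- For the cubic Q, first divided differences at consecutive eigenvalues are θ_iθ_j; second ones
  -- give θ_j = Q_2 + Q_3(θ_i + θ_j + θ_k). Subtracting two neighbouring instances gives the
  -- recurrence with κ = Q_3.
  · have hne : ∀ {i j : Fin (d + 1)}, (i : ℕ) ≠ j → θ i - θ j ≠ 0 := fun h =>
      sub_ne_zero.2 fun h' => h (congrArg Fin.val (H.inj h'))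
    have q : ∀ i j : Fin (d + 1), (i : ℕ) = j + 1 → θ i * θ j =
        Q.coeff 1 + Q.coeff 2 * (θ i + θ j) + Q.coeff 3 * (θ i ^ 2 + θ i * θ j + θ j ^ 2) := by
      intro i j h
      have := hQ i j h
      rw [hev, hev] at this
      refine mul_right_cancel₀ (hne (i := i) (j := j) (by omega)) ?_
      linear_combination -this
    have r : ∀ i j k : Fin (d + 1), (j : ℕ) = i + 1 → (k : ℕ) = i + 2 →
        θ j = Q.coeff 2 + Q.coeff 3 * (θ i + θ j + θ k) := by
      intro i j k hj hk
      refine mul_right_cancel₀ (hne (i := k) (j := i) (by omega)) ?_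
      linear_combination q k j (by omega) - q j i (by omega)
    linear_combination r i₁ i₂ i₃ (by omega) (by omega) - r i₀ i₁ i₂ h1 h2
  -- Three places below the diagonal, each term is a scalar times the same nonzero entry of M³.
  · have := hent i₃ i₀
    rw [H.tri.pow_mul_diagonal_mul_pow_apply θs 2 1 (k := i₁) (by omega) (by omega),
      H.tri.pow_mul_diagonal_mul_pow_apply θs 1 2 (k := i₂) (by omega) (by omega),
      H.tri.aeval_apply_eq hdeg h3] at this
    refine mul_right_cancel₀ (H.tri.pow_apply_ne_zero 3 h3) ?_
    linear_combination -this

/-- A split basis exists, with nonzero scalars. -/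
theorem exists_split : ∃ (u : Basis (Fin (d + 1)) K V) (c : Fin d → K), (∀ i, c i ≠ 0) ∧
    (∀ i : Fin d, a (u i.castSucc) = θ i.castSucc • u i.castSucc + u i.succ) ∧
    a (u (Fin.last d)) = θ (Fin.last d) • u (Fin.last d) ∧
    (∀ i : Fin d, b (u i.succ) = c i • u i.castSucc + θs i.succ • u i.succ) ∧
    b (u 0) = θs 0 • u 0 := by
  set t : ℕ → K := natExtend θ with ht
  have htθ : ∀ i : Fin (d + 1), t i = θ i := natExtend_val θ
  set τ : ℕ → K[X] := fun n => ∏ k ∈ Finset.range n, (X - C (t k)) with hτ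
  have hτs : ∀ n, τ (n + 1) = (X - C (t n)) * τ n := fun n => by
    rw [hτ]; simp only [Finset.prod_range_succ]; ring
  have hmonic : ∀ n, (τ n).Monic := fun n => monic_prod_X_sub_C _ _
  have hdeg : ∀ n, (τ n).natDegree = n := fun n => by
    rw [hτ]; simp [natDegree_prod_of_monic _ _ fun k _ => monic_X_sub_C (t k)]
  set u₀ : Fin (d + 1) → V := fun j => aeval a (τ j) (e 0) with hu₀
  have he : ∀ i j, e.toMatrix u₀ i j = aeval (LinearMap.toMatrixAlgEquiv e a) (τ j) i 0 := by
    intro i j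
    have hae : LinearMap.toMatrixAlgEquiv e (aeval a (τ j)) =
        aeval (LinearMap.toMatrixAlgEquiv e a) (τ j) :=
      (aeval_algHom_apply (LinearMap.toMatrixAlgEquiv e).toAlgHom a (τ j)).symm
    rw [← hae, LinearMap.toMatrixAlgEquiv_apply, Basis.toMatrix_apply]
  -- τ_j(A) has degree j and A is tridiagonal with respect to e, so u_j lies in the span of e_0, …,
  -- e_j with nonzero e_j-coordinate.
  have hup₀ : Matrix.BlockTriangular (e.toMatrix u₀) id := fun i j hij => by
    rw [he, H.tri.aeval_apply_eq_zero (hdeg j).le (by simpa using hij)]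
  have hdiag₀ : ∀ i, e.toMatrix u₀ i i ≠ 0 := fun i => by
    rw [he, H.tri.aeval_apply_eq (hdeg i).le (by simp)]
    have : (τ i).coeff i = 1 := by simpa [Monic, leadingCoeff, hdeg] using hmonic i
    rw [this, one_mul]
    exact H.tri.pow_apply_ne_zero _ (by simp)
  have hbasis : LinearIndependent K u₀ ∧ Submodule.span K (Set.range u₀) = ⊤ := by
    rw [Basis.is_basis_iff_det e, Basis.det_apply, Matrix.det_of_isUpperTriangular hup₀,
      isUnit_iff_ne_zero]
    exact Finset.prod_ne_zero_iff.2 fun i _ => hdiag₀ i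
  set u : Basis (Fin (d + 1)) K V := Basis.mk hbasis.1 hbasis.2.ge with hu
  have huu : ⇑u = u₀ := Basis.coe_mk _ _
  have hup : Matrix.BlockTriangular (e.toMatrix u) id := by rwa [huu]
  have hwu : ∀ i j, w.toMatrix u i j = (τ j).eval (θ i) * w.repr (e 0) i := fun i j => by
    rw [Basis.toMatrix_apply, huu]
    exact repr_apply_of_eigenbasis (aeval_apply_of_eigenbasis H.eig _) _ _
  have hroot : ∀ (i : Fin (d + 1)) (n : ℕ), (i : ℕ) < n → (τ n).eval (θ i) = 0 := fun i n h => by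
    rw [hτ, eval_prod]
    exact Finset.prod_eq_zero (Finset.mem_range.2 h) (by simp [htθ])
  -- τ_j kills w_i for i < j, so u_j lies in the span of w_j, …, w_d.
  have hlow : Matrix.BlockTriangular (w.toMatrix u) OrderDual.toDual := fun i j hij => by
    rw [hwu, hroot i j hij, zero_mul]
  have hup' := blockTriangular_toMatrix_flip u e hup
  have hupd := toMatrix_flip_mul_diag Function.injective_id u e hup
  have hlow' := blockTriangular_toMatrix_flip u w hlow
  have hlowd := toMatrix_flip_mul_diag OrderDual.toDual.injective u w hlow
  have hau : ∀ n : ℕ, a (aeval a (τ n) (e 0)) =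
      t n • aeval a (τ n) (e 0) + aeval a (τ (n + 1)) (e 0) := fun n => by
    rw [hτs, map_mul, Module.End.mul_apply]
    simp
  -- The matrix of b in the basis u is computed twice. Through e it is upper triangular with
  -- diagonal θ*_j; through w it vanishes more than one place above the diagonal.
  have hE : ∀ j m, u.repr (b (u j)) m =
      ∑ i, e.toMatrix u i j * (θs i * u.toMatrix e m i) := by
    intro j m
    refine (e.apply_eq_sum_repr_mul (u.coord m ∘ₗ b) (u j)).trans ?_
    simp [H.eig_star, Basis.toMatrix_apply]
  have hW : ∀ j m, u.repr (b (u j)) m =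
      ∑ i, ∑ k, w.toMatrix u i j * (LinearMap.toMatrixAlgEquiv w b k i * u.toMatrix w m k) := by
    intro j m
    refine (w.apply_eq_sum_repr_mul (u.coord m ∘ₗ b) (u j)).trans
      (Finset.sum_congr rfl fun i _ => ?_)
    rw [LinearMap.comp_apply, w.apply_eq_sum_repr_mul (u.coord m) (b (w i)), Finset.mul_sum]
    simp [LinearMap.toMatrixAlgEquiv_apply, Basis.toMatrix_apply]
  have hgt : ∀ j m, j < m → u.repr (b (u j)) m = 0 := fun j m hjm => by
    rw [hE]
    refine Finset.sum_eq_zero fun i _ => ?_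
    rcases lt_or_ge j i with h | h
    · rw [hup h, zero_mul]
    · rw [hup' (show id i < id m from lt_of_le_of_lt h hjm), mul_zero, mul_zero]
  have heq : ∀ j, u.repr (b (u j)) j = θs j := fun j => by
    rw [hE, Finset.sum_eq_single j]
    · linear_combination θs j * hupd j
    · intro i _ hij
      rcases lt_or_gt_of_ne hij with h | h
      · rw [hup' (show id i < id j from h), mul_zero, mul_zero]
      · rw [hup (show id j < id i from h), zero_mul]
    · simp
  have hlt : ∀ j m : Fin (d + 1), (m : ℕ) + 1 < j → u.repr (b (u j)) m = 0 := fun j m hjm => by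
    rw [hW]
    refine Finset.sum_eq_zero fun i _ => Finset.sum_eq_zero fun k _ => ?_
    rcases lt_or_ge i j with h | h
    · rw [hlow (show OrderDual.toDual j < OrderDual.toDual i from h), zero_mul]
    rcases lt_or_ge m k with h' | h'
    · rw [hlow' (show OrderDual.toDual k < OrderDual.toDual m from h'), mul_zero, mul_zero]
    · rw [H.tri_star.eq_zero_of_gt (by omega), zero_mul, mul_zero]
  have hpred : ∀ j m : Fin (d + 1), (m : ℕ) + 1 = j → u.repr (b (u j)) m ≠ 0 := by
    intro j m hjm
    -- Just above the diagonal a single product survives: two nonzero diagonal entries of triangular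
    -- matrices and a nonzero superdiagonal entry of b.
    rw [hW, Finset.sum_eq_single j, Finset.sum_eq_single m]
    · exact mul_ne_zero (right_ne_zero_of_mul_eq_one (hlowd j))
        (mul_ne_zero (H.tri_star.ne_zero_of_pred hjm.symm)
          (left_ne_zero_of_mul_eq_one (hlowd m)))
    · intro k _ hk
      rcases lt_or_gt_of_ne hk with h | h
      · rw [H.tri_star.eq_zero_of_gt (by omega), zero_mul, mul_zero]
      · rw [hlow' (show OrderDual.toDual k < OrderDual.toDual m from h), mul_zero, mul_zero]
    · simp
    · intro i _ hi
      refine Finset.sum_eq_zero fun k _ => ?_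
      rcases lt_or_gt_of_ne hi with h | h
      · rw [hlow (show OrderDual.toDual j < OrderDual.toDual i from h), zero_mul]
      rcases lt_or_ge m k with h' | h'
      · rw [hlow' (show OrderDual.toDual k < OrderDual.toDual m from h'), mul_zero, mul_zero]
      · rw [H.tri_star.eq_zero_of_gt (by omega), zero_mul, mul_zero]
    · simp
  refine ⟨u, fun i => u.repr (b (u i.succ)) i.castSucc, fun i => hpred _ _ (by simp),
    fun i => ?_, ?_, fun i => u.ext_elem fun m => ?_, u.ext_elem fun m => ?_⟩
  · rw [huu, hu₀]
    have := hau i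
    rw [← Fin.val_castSucc i, htθ] at this
    simpa using this
  -- τ_{d+1} vanishes at every eigenvalue, so the raising chain stops at u_d.
  · have hz : aeval a (τ (d + 1)) (e 0) = 0 := w.ext_elem fun i => by
      rw [repr_apply_of_eigenbasis (aeval_apply_of_eigenbasis H.eig _), hroot i _ i.2]
      simp
    rw [huu, hu₀]
    have := hau d
    rw [hz, add_zero] at this
    rw [← htθ]
    simpa using this
  · simp only [map_add, map_smul, Finsupp.add_apply, Finsupp.smul_apply, Basis.repr_self,
      smul_eq_mul]
    rcases lt_trichotomy m i.succ with h | rfl | h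
    · rcases eq_or_ne m i.castSucc with rfl | h'
      · simp [Fin.ext_iff]
      · have h1 : (m : ℕ) < i + 1 := by simpa [Fin.lt_def] using h
        have h2 : (m : ℕ) ≠ i := fun h => h' (Fin.ext (by simpa using h))
        rw [hlt _ _ (by simp; omega), Finsupp.single_eq_of_ne h', Finsupp.single_eq_of_ne h.ne]
        ring
    · simp [heq, Fin.ext_iff]
    · have h1 : i.castSucc < m := lt_trans i.castSucc_lt_succ h
      rw [hgt _ _ h, Finsupp.single_eq_of_ne h1.ne', Finsupp.single_eq_of_ne h.ne']
      ring
  · simp only [map_smul, Finsupp.smul_apply, Basis.repr_self, smul_eq_mul]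
    rcases eq_or_ne m 0 with rfl | h
    · simp [heq]
    · rw [hgt _ _ (Fin.pos_of_ne_zero h), Finsupp.single_eq_of_ne h, mul_zero]

end IsLeonardBases

end LeonardBases

/-! ### Corner entries of polynomials in A and A* via split bases. -/

section SplitEvaluation

open Module

variable {K V : Type*} [Field K] [AddCommGroup V] [Module K V] {d : ℕ}

/-- Two telescopings: each factor X - t_i replaces Λ_i by r_i Λ_{i+1}, and then Λ_n(1) is brought
back to Λ_0(1), each step trading s_0 - s_{i+1} for r'_i. In the applications one of r, r' is the
split sequence and the other is 1. -/
theorem apply_prod_X_sub_C_mul_prod_sub (Λ : ℕ → K[X] →ₗ[K] K) (t r s r' : ℕ → K) (n : ℕ)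
    (h1 : ∀ i < n, ∀ p, Λ i (X * p) = t i * Λ i p + r i * Λ (i + 1) p)
    (h2 : ∀ i < n, s 0 * Λ (i + 1) 1 = s (i + 1) * Λ (i + 1) 1 + r' i * Λ i 1) :
    Λ 0 (∏ k ∈ Finset.range n, (X - C (t k))) * ∏ k ∈ Finset.range n, (s 0 - s (k + 1)) =
      (∏ k ∈ Finset.range n, r k) * (∏ k ∈ Finset.range n, r' k) * Λ 0 1 := by
  have hA : ∀ m ≤ n, ∀ p, Λ 0 ((∏ k ∈ Finset.range m, (X - C (t k))) * p) =
      (∏ k ∈ Finset.range m, r k) * Λ m p := by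
    intro m
    induction m with
    | zero => simp
    | succ m ih =>
      intro hm p
      have : Λ m ((X - C (t m)) * p) = r m * Λ (m + 1) p := by
        rw [sub_mul, map_sub, h1 m (by omega), ← smul_eq_C_mul, map_smul, smul_eq_mul]
        ring
      rw [Finset.prod_range_succ, mul_assoc, ih (by omega), this, Finset.prod_range_succ, mul_assoc]
  have hB : ∀ m ≤ n, Λ m 1 * ∏ k ∈ Finset.range m, (s 0 - s (k + 1)) =
      (∏ k ∈ Finset.range m, r' k) * Λ 0 1 := by
    intro m
    induction m with
    | zero => simp
    | succ m ih =>
      intro hm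
      rw [Finset.prod_range_succ, Finset.prod_range_succ]
      linear_combination (∏ k ∈ Finset.range m, (s 0 - s (k + 1))) * h2 m (by omega) +
        r' m * ih (by omega)
  have := hA n le_rfl 1
  rw [mul_one] at this
  rw [this, mul_assoc, hB n le_rfl, mul_assoc]

theorem aeval_X_mul_apply (f : End K V) (p : K[X]) (x : V) :
    aeval f (X * p) x = aeval f p (f x) := by
  rw [mul_comm, map_mul, aeval_X, Module.End.mul_apply]

theorem eq_smul_of_eigenbasis {ι : Type*} {b : End K V} {e : Basis ι K V} {θ : ι → K}
    (h : ∀ i, b (e i) = θ i • e i) (hinj : Function.Injective θ) {x : V} {k : ι}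
    (hx : b x = θ k • x) : x = e.repr x k • e k := by
  refine e.ext_elem fun i => ?_
  rcases eq_or_ne i k with rfl | hi
  · simp
  · have := repr_apply_of_eigenbasis h x i
    rw [hx, map_smul, Finsupp.smul_apply, smul_eq_mul] at this
    have h0 : e.repr x i = 0 :=
      (mul_eq_zero.1 (show (θ k - θ i) * e.repr x i = 0 by linear_combination this)).resolve_left
        (sub_ne_zero.2 fun h => hi (hinj h.symm))
    simp [h0, hi]

theorem dual_eq_smul_of_eigenbasis {ι : Type*} {b : End K V} {e : Basis ι K V} {θ : ι → K}
    (h : ∀ i, b (e i) = θ i • e i) (hinj : Function.Injective θ) {f : V →ₗ[K] K} {k : ι}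
    (hf : ∀ x, f (b x) = θ k * f x) : f = f (e k) • e.coord k := by
  refine e.ext fun i => ?_
  rcases eq_or_ne i k with rfl | hi
  · simp
  · have := hf (e i)
    rw [h, map_smul, smul_eq_mul] at this
    have h0 : f (e i) = 0 :=
      (mul_eq_zero.1 (show (θ i - θ k) * f (e i) = 0 by linear_combination this)).resolve_left
        (sub_ne_zero.2 fun h => hi (hinj h))
    simp [h0, hi]

/-- The `k`-th diagonal entry of `p(b)` with respect to the basis `w`, as a functional of `p`. -/
noncomputable def diagonalEntry {ι : Type*} (w : Basis ι K V) (b : End K V) (k : ι) :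
    K[X] →ₗ[K] K :=
  w.coord k ∘ₗ LinearMap.applyₗ (w k) ∘ₗ (aeval b).toLinearMap

theorem diagonalEntry_apply {ι : Type*} (w : Basis ι K V) (b : End K V) (k : ι) (p : K[X]) :
    diagonalEntry w b k p = w.coord k (aeval b p (w k)) :=
  rfl

/-- The vectors of `u`, continued by `0`. -/
noncomputable def basisExtend (u : Basis (Fin (d + 1)) K V) (n : ℕ) : V :=
  if h : n < d + 1 then u ⟨n, h⟩ else 0

/-- The coordinate functionals of `u`, continued by `0`. -/
noncomputable def coordExtend (u : Basis (Fin (d + 1)) K V) (n : ℕ) : V →ₗ[K] K :=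
  if h : n < d + 1 then u.coord ⟨n, h⟩ else 0

theorem basisExtend_val (u : Basis (Fin (d + 1)) K V) (i : Fin (d + 1)) :
    basisExtend u i = u i :=
  dif_pos i.2

theorem basisExtend_succ_last (u : Basis (Fin (d + 1)) K V) : basisExtend u (d + 1) = 0 :=
  dif_neg (lt_irrefl _)

theorem coordExtend_val (u : Basis (Fin (d + 1)) K V) (i : Fin (d + 1)) :
    coordExtend u i = u.coord i :=
  dif_pos i.2

theorem coordExtend_succ_last (u : Basis (Fin (d + 1)) K V) : coordExtend u (d + 1) = 0 :=
  dif_neg (lt_irrefl _)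

theorem coordExtend_basisExtend (u : Basis (Fin (d + 1)) K V) {n : ℕ} (hn : n ≤ d) (m : ℕ) :
    coordExtend u n (basisExtend u m) = if n = m then 1 else 0 := by
  unfold coordExtend basisExtend
  rw [dif_pos (by omega)]
  split_ifs with h1 h2 h2
  · subst h2; simp
  · simp only [Basis.coord_apply, Basis.repr_self]
    exact Finsupp.single_eq_of_ne (by simpa [Fin.ext_iff] using h2)
  · omega
  · simp

/-- `u` is a split basis for the pair `a, b` with scalars `c`. -/
structure IsSplitPair (a b : End K V) (u : Basis (Fin (d + 1)) K V) (θ θs : Fin (d + 1) → K)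
    (c : Fin d → K) : Prop where
  raise : ∀ i : Fin d, a (u i.castSucc) = θ i.castSucc • u i.castSucc + u i.succ
  raise_last : a (u (Fin.last d)) = θ (Fin.last d) • u (Fin.last d)
  lower : ∀ i : Fin d, b (u i.succ) = c i • u i.castSucc + θs i.succ • u i.succ
  lower_zero : b (u 0) = θs 0 • u 0

namespace IsSplitPair

variable {a b : End K V} {u : Basis (Fin (d + 1)) K V} {θ θs : Fin (d + 1) → K} {c : Fin d → K}
  (S : IsSplitPair a b u θ θs c)
include S

theorem apply_basisExtend {n : ℕ} (hn : n ≤ d) :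
    a (basisExtend u n) = natExtend θ n • basisExtend u n + basisExtend u (n + 1) := by
  rcases hn.lt_or_eq with h | rfl
  · have := S.raise ⟨n, h⟩
    rwa [← natExtend_val θ, ← basisExtend_val, ← basisExtend_val] at this
  · have := S.raise_last
    rw [basisExtend_succ_last, add_zero]
    rwa [← natExtend_val θ, ← basisExtend_val] at this

theorem star_apply_basisExtend_zero :
    b (basisExtend u 0) = natExtend θs 0 • basisExtend u 0 := by
  have := S.lower_zero
  rwa [← natExtend_val θs, ← basisExtend_val] at this

theorem star_apply_basisExtend_succ {n : ℕ} (hn : n < d) :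
    b (basisExtend u (n + 1)) =
      natExtend c n • basisExtend u n + natExtend θs (n + 1) • basisExtend u (n + 1) := by
  have := S.lower ⟨n, hn⟩
  rwa [← natExtend_val θs, ← natExtend_val c, ← basisExtend_val, ← basisExtend_val] at this

/-- The split relations transposed: on the coordinate functionals A lowers the index and A* raises
it. -/
theorem coordExtend_zero_apply (x : V) :
    coordExtend u 0 (a x) = natExtend θ 0 * coordExtend u 0 x := by
  suffices coordExtend u 0 ∘ₗ a = natExtend θ 0 • coordExtend u 0 from LinearMap.congr_fun this x
  refine u.ext fun m => ?_
  rw [← basisExtend_val]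
  simp only [LinearMap.comp_apply, LinearMap.smul_apply, S.apply_basisExtend m.is_le, map_add,
    map_smul, smul_eq_mul, coordExtend_basisExtend u (Nat.zero_le d)]
  by_cases h : 0 = (m : ℕ)
  · simp [← h]
  · simp [h]

theorem coordExtend_succ_apply {n : ℕ} (hn : n < d) (x : V) :
    coordExtend u (n + 1) (a x) =
      natExtend θ (n + 1) * coordExtend u (n + 1) x + coordExtend u n x := by
  suffices coordExtend u (n + 1) ∘ₗ a =
      natExtend θ (n + 1) • coordExtend u (n + 1) + coordExtend u n from
    LinearMap.congr_fun this x
  refine u.ext fun m => ?_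
  rw [← basisExtend_val]
  simp only [LinearMap.comp_apply, LinearMap.smul_apply, LinearMap.add_apply,
    S.apply_basisExtend m.is_le, map_add, map_smul, smul_eq_mul,
    coordExtend_basisExtend u (Nat.succ_le_of_lt hn), coordExtend_basisExtend u hn.le]
  by_cases h : n + 1 = (m : ℕ)
  · simp [← h]
  · simp [h]

theorem coordExtend_star_apply {n : ℕ} (hn : n ≤ d) (x : V) :
    coordExtend u n (b x) =
      natExtend θs n * coordExtend u n x + natExtend c n * coordExtend u (n + 1) x := by
  suffices coordExtend u n ∘ₗ b =
      natExtend θs n • coordExtend u n + natExtend c n • coordExtend u (n + 1) from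
    LinearMap.congr_fun this x
  refine u.ext fun m => ?_
  rw [← basisExtend_val]
  simp only [LinearMap.comp_apply, LinearMap.smul_apply, LinearMap.add_apply]
  have hsucc : ∀ m ≤ d, coordExtend u (n + 1) (basisExtend u m) = if n + 1 = m then 1 else 0 := by
    intro m hm
    rcases hn.lt_or_eq with h | rfl
    · exact coordExtend_basisExtend u h m
    · rw [coordExtend_succ_last, if_neg (by omega), LinearMap.zero_apply]
  obtain ⟨m, hm⟩ := m
  rw [hsucc _ (by simpa [Nat.lt_succ_iff] using hm)]
  cases m with
  | zero =>
    simp only [S.star_apply_basisExtend_zero, map_smul, smul_eq_mul,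
      coordExtend_basisExtend u hn]
    by_cases h : n = 0
    · simp [h]
    · simp [h]
  | succ m =>
    simp only [S.star_apply_basisExtend_succ (show m < d by omega), map_add, map_smul,
      smul_eq_mul, coordExtend_basisExtend u hn]
    by_cases h : n = m + 1
    · simp [h]
    · by_cases h' : n = m
      · simp [h']
      · simp [h, h']

variable {w e : Basis (Fin (d + 1)) K V}

/-- Being an eigenvector of b for θ*_0, u_0 is a multiple of e_0. Raising takes it to u_n, and the
e_0-coordinates of the u_n obey a one-step recursion coming from the lowering relation. -/
theorem diagonalEntry_zero_tau (he : ∀ i, b (e i) = θs i • e i) (hinj : Function.Injective θs)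
    {n : ℕ} (hn : n ≤ d) :
    diagonalEntry e a 0 (∏ k ∈ Finset.range n, (X - C (natExtend θ k))) *
      ∏ k ∈ Finset.range n, (natExtend θs 0 - natExtend θs (k + 1)) =
    ∏ k ∈ Finset.range n, natExtend c k := by
  have hu := eq_smul_of_eigenbasis he hinj S.lower_zero
  have h0 : e.repr (u 0) 0 ≠ 0 := fun h => u.ne_zero 0 (by rw [hu, h, zero_smul])
  have key := apply_prod_X_sub_C_mul_prod_sub
    (fun i => e.coord 0 ∘ₗ LinearMap.applyₗ (basisExtend u i) ∘ₗ (aeval a).toLinearMap)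
    (natExtend θ) (fun _ => 1) (natExtend θs) (natExtend c) n
    (fun i hi p => by
      simp only [LinearMap.comp_apply, LinearMap.applyₗ_apply_apply, AlgHom.toLinearMap_apply,
        aeval_X_mul_apply, S.apply_basisExtend (n := i) (by omega)]
      simp)
    (fun i hi => by
      have h1 := repr_apply_of_eigenbasis he (basisExtend u (i + 1)) 0
      rw [S.star_apply_basisExtend_succ (by omega)] at h1
      have h2 : natExtend θs 0 = θs 0 := natExtend_val θs 0
      simp only [map_add, map_smul, Finsupp.add_apply, Finsupp.smul_apply, smul_eq_mul] at h1
      simp [h2]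
      linear_combination -h1)
  have h1 : ∀ p, e.coord 0 (aeval a p (basisExtend u 0)) =
      e.repr (u 0) 0 * diagonalEntry e a 0 p := fun p => by
    have : basisExtend u 0 = u 0 := basisExtend_val u 0
    rw [this, diagonalEntry_apply]
    conv_lhs => rw [hu]
    simp only [map_smul, smul_eq_mul]
  have h2 : diagonalEntry e a 0 1 = 1 := by simp [diagonalEntry_apply]
  simp only [LinearMap.comp_apply, LinearMap.applyₗ_apply_apply, AlgHom.toLinearMap_apply, h1, h2,
    Finset.prod_const_one] at key
  refine mul_left_cancel₀ h0 ?_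
  linear_combination key

/-- The dual argument: the last coordinate functional of u is a left eigenvector of b, hence a
multiple of the last coordinate functional of e, and a moves it down the dual basis. The index d - k
- 1 counts from 0, so it denotes split scalar number d - k. -/
theorem diagonalEntry_last_eta (he : ∀ i, b (e i) = θs i • e i) (hinj : Function.Injective θs)
    {n : ℕ} (hn : n ≤ d) :
    diagonalEntry e a (Fin.last d) (∏ k ∈ Finset.range n, (X - C (natExtend θ (d - k)))) *
      ∏ k ∈ Finset.range n, (natExtend θs d - natExtend θs (d - (k + 1))) =
    ∏ k ∈ Finset.range n, natExtend c (d - k - 1) := by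
  have hlast : coordExtend u d = u.coord (Fin.last d) := coordExtend_val u (Fin.last d)
  have hs : natExtend θs d = θs (Fin.last d) := natExtend_val θs (Fin.last d)
  have hu := dual_eq_smul_of_eigenbasis he hinj (f := coordExtend u d) (k := Fin.last d)
    (fun x => by
      rw [S.coordExtend_star_apply le_rfl, coordExtend_succ_last, hs]; simp)
  have h0 : coordExtend u d (e (Fin.last d)) ≠ 0 := fun h => by
    rw [h, zero_smul, hlast] at hu
    simpa using LinearMap.congr_fun hu (u (Fin.last d))
  have key := apply_prod_X_sub_C_mul_prod_sub
    (fun i => coordExtend u (d - i) ∘ₗ LinearMap.applyₗ (e (Fin.last d)) ∘ₗ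
      (aeval a).toLinearMap)
    (fun k => natExtend θ (d - k)) (fun _ => 1) (fun k => natExtend θs (d - k))
    (fun k => natExtend c (d - k - 1)) n
    (fun i hi p => by
      have h1 := S.coordExtend_succ_apply (n := d - (i + 1)) (by omega)
        (aeval a p (e (Fin.last d)))
      rw [show d - (i + 1) + 1 = d - i by omega] at h1
      simp [h1])
    (fun i hi => by
      have h1 := S.coordExtend_star_apply (n := d - (i + 1)) (by omega) (e (Fin.last d))
      rw [show d - (i + 1) + 1 = d - i by omega, he, map_smul, smul_eq_mul] at h1
      simpa [hs, Nat.sub_sub] using h1)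
  have h1 : ∀ p, coordExtend u (d - 0) (aeval a p (e (Fin.last d))) =
      coordExtend u d (e (Fin.last d)) * diagonalEntry e a (Fin.last d) p := fun p => by
    rw [Nat.sub_zero, diagonalEntry_apply]
    conv_lhs => rw [hu]
    rw [LinearMap.smul_apply, smul_eq_mul]
  have h2 : diagonalEntry e a (Fin.last d) 1 = 1 := by simp [diagonalEntry_apply]
  simp only [LinearMap.comp_apply, LinearMap.applyₗ_apply_apply, AlgHom.toLinearMap_apply, h1, h2,
    Finset.prod_const_one] at key
  refine mul_left_cancel₀ h0 ?_
  rw [Nat.sub_zero] at key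
  linear_combination key

/-- The roles of a and b are exchanged: u_d is an eigenvector of a, b moves it down with the split
scalars as factors, and the raising relation controls the last w-coordinate. -/
theorem diagonalEntry_star_last_eta (hw : ∀ i, a (w i) = θ i • w i)
    (hinj : Function.Injective θ) {n : ℕ} (hn : n ≤ d) :
    diagonalEntry w b (Fin.last d) (∏ k ∈ Finset.range n, (X - C (natExtend θs (d - k)))) *
      ∏ k ∈ Finset.range n, (natExtend θ d - natExtend θ (d - (k + 1))) =
    ∏ k ∈ Finset.range n, natExtend c (d - k - 1) := by
  have hu := eq_smul_of_eigenbasis hw hinj S.raise_last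
  have hs : natExtend θ d = θ (Fin.last d) := natExtend_val θ (Fin.last d)
  have h0 : w.repr (u (Fin.last d)) (Fin.last d) ≠ 0 := fun h =>
    u.ne_zero (Fin.last d) (by rw [hu, h, zero_smul])
  have key := apply_prod_X_sub_C_mul_prod_sub
    (fun i => w.coord (Fin.last d) ∘ₗ LinearMap.applyₗ (basisExtend u (d - i)) ∘ₗ
      (aeval b).toLinearMap)
    (fun k => natExtend θs (d - k)) (fun k => natExtend c (d - k - 1))
    (fun k => natExtend θ (d - k)) (fun _ => 1) n
    (fun i hi p => by
      have h1 := S.star_apply_basisExtend_succ (n := d - (i + 1)) (by omega)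
      rw [show d - (i + 1) + 1 = d - i by omega] at h1
      simp only [LinearMap.comp_apply, LinearMap.applyₗ_apply_apply, AlgHom.toLinearMap_apply,
        aeval_X_mul_apply, h1]
      simp [Nat.sub_sub, add_comm])
    (fun i hi => by
      have h1 := repr_apply_of_eigenbasis hw (basisExtend u (d - (i + 1))) (Fin.last d)
      rw [S.apply_basisExtend (by omega), show d - (i + 1) + 1 = d - i by omega] at h1
      simp only [map_add, map_smul, Finsupp.add_apply, Finsupp.smul_apply, smul_eq_mul] at h1
      simp [hs]
      linear_combination -h1)
  have h1 : ∀ p, w.coord (Fin.last d) (aeval b p (basisExtend u (d - 0))) =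
      w.repr (u (Fin.last d)) (Fin.last d) * diagonalEntry w b (Fin.last d) p := fun p => by
    have : basisExtend u d = u (Fin.last d) := basisExtend_val u (Fin.last d)
    rw [Nat.sub_zero, this, diagonalEntry_apply]
    conv_lhs => rw [hu]
    simp only [map_smul, smul_eq_mul]
  have h2 : diagonalEntry w b (Fin.last d) 1 = 1 := by simp [diagonalEntry_apply]
  simp only [LinearMap.comp_apply, LinearMap.applyₗ_apply_apply, AlgHom.toLinearMap_apply, h1, h2,
    Finset.prod_const_one] at key
  refine mul_left_cancel₀ h0 ?_
  rw [Nat.sub_zero] at key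
  linear_combination key

/-- Here the zeroth coordinate functional of u is a left eigenvector of a, and b moves it up the
dual basis. -/
theorem diagonalEntry_star_zero_tau (hw : ∀ i, a (w i) = θ i • w i)
    (hinj : Function.Injective θ) {n : ℕ} (hn : n ≤ d) :
    diagonalEntry w b 0 (∏ k ∈ Finset.range n, (X - C (natExtend θs k))) *
      ∏ k ∈ Finset.range n, (natExtend θ 0 - natExtend θ (k + 1)) =
    ∏ k ∈ Finset.range n, natExtend c k := by
  have hs : natExtend θ 0 = θ 0 := natExtend_val θ 0
  have hu := dual_eq_smul_of_eigenbasis hw hinj (f := coordExtend u 0) (k := 0)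
    (fun x => by rw [S.coordExtend_zero_apply, hs])
  have h0 : coordExtend u 0 (w 0) ≠ 0 := fun h => by
    have hz : coordExtend u 0 = u.coord 0 := coordExtend_val u 0
    rw [h, zero_smul, hz] at hu
    simpa using LinearMap.congr_fun hu (u 0)
  have key := apply_prod_X_sub_C_mul_prod_sub
    (fun i => coordExtend u i ∘ₗ LinearMap.applyₗ (w 0) ∘ₗ (aeval b).toLinearMap)
    (natExtend θs) (natExtend c) (natExtend θ) (fun _ => 1) n
    (fun i hi p => by
      simp [S.coordExtend_star_apply (n := i) (by omega)])
    (fun i hi => by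
      have h1 := S.coordExtend_succ_apply (n := i) (by omega) (w 0)
      rw [hw, map_smul, smul_eq_mul] at h1
      simpa [hs] using h1)
  have h1 : ∀ p, coordExtend u 0 (aeval b p (w 0)) =
      coordExtend u 0 (w 0) * diagonalEntry w b 0 p := fun p => by
    rw [diagonalEntry_apply]
    conv_lhs => rw [hu]
    rw [LinearMap.smul_apply, smul_eq_mul]
  have h2 : diagonalEntry w b 0 1 = 1 := by simp [diagonalEntry_apply]
  simp only [LinearMap.comp_apply, LinearMap.applyₗ_apply_apply, AlgHom.toLinearMap_apply, h1, h2,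
    Finset.prod_const_one] at key
  refine mul_left_cancel₀ h0 ?_
  linear_combination key

end IsSplitPair

end SplitEvaluation

/-! ### From the abstract algebra to endomorphisms of V. -/

section SimpleModule

open Module

variable {K 𝒜 : Type*} [Field K] [Ring 𝒜] [Algebra K 𝒜] {d : ℕ}
  (V : Type*) [AddCommGroup V] [Module K V] [Module 𝒜 V] [IsScalarTower K 𝒜 V]
  [IsSimpleModule 𝒜 V]

/-- A simple module over the algebra of `d + 1` by `d + 1` matrices is spanned by `d + 1`
vectors. -/
theorem exists_span_range_eq_top_of_matrix (g : 𝒜 ≃ₐ[K] Matrix (Fin (d + 1)) (Fin (d + 1)) K) :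
    ∃ v : Fin (d + 1) → V, Submodule.span K (Set.range v) = ⊤ := by
  have := IsSimpleModule.nontrivial 𝒜 V
  obtain ⟨x, hx⟩ := exists_ne (0 : V)
  set m : Fin (d + 1) → Fin (d + 1) → 𝒜 := fun i j => g.symm (Matrix.single i j 1) with hm
  have hsum : ∑ i, m i i = 1 := by
    rw [hm, ← map_sum, Matrix.sum_single_one, map_one]
  have hdec : ∀ r : 𝒜, r = ∑ i, ∑ j, g r i j • m i j := fun r => by
    apply g.injective
    simp only [hm, map_sum, map_smul, AlgEquiv.apply_symm_apply, Matrix.smul_single, smul_eq_mul,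
      mul_one]
    exact Matrix.matrix_eq_sum_single (g r)
  -- The diagonal matrix units sum to 1, so one of them does not kill x; the corresponding column of
  -- matrix units then generates V over K.
  obtain ⟨j, hj⟩ : ∃ j, m j j • x ≠ 0 := by
    by_contra! h
    exact hx (by rw [← one_smul 𝒜 x, ← hsum, Finset.sum_smul, Finset.sum_eq_zero fun i _ => h i])
  have hmm : ∀ k l, m k l * m j j = if l = j then m k j else 0 := fun k l => by
    split_ifs with h
    · subst h; simp [hm, ← map_mul]
    · simp [hm, ← map_mul, h]
  refine ⟨fun i => m i j • x, eq_top_iff.2 fun y _ => ?_⟩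
  obtain ⟨r, rfl⟩ := IsSimpleModule.toSpanSingleton_surjective 𝒜 hj y
  rw [LinearMap.toSpanSingleton_apply]
  have : r • m j j • x = ∑ k, g r k j • m k j • x := by
    conv_lhs => rw [hdec r]
    rw [← mul_smul, Finset.sum_mul, Finset.sum_smul]
    refine Finset.sum_congr rfl fun k _ => ?_
    rw [Finset.sum_mul, Finset.sum_eq_single j]
    · rw [smul_mul_assoc, hmm, if_pos rfl, smul_assoc]
    · intro l _ hl
      rw [smul_mul_assoc, hmm, if_neg hl, smul_zero]
    · simp
  rw [this]
  exact Submodule.sum_mem _ fun k _ => Submodule.smul_mem _ _ (Submodule.subset_span ⟨k, rfl⟩)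

/-- The spanning family gives dim V ≤ d + 1. As 𝒜 is simple it acts faithfully, so (d + 1)² ≤ (dim
V)²; equality of dimensions makes the action bijective. -/
theorem finrank_eq_and_lsmul_bijective (g : 𝒜 ≃ₐ[K] Matrix (Fin (d + 1)) (Fin (d + 1)) K) :
    Module.Finite K V ∧ finrank K V = d + 1 ∧
      Function.Bijective (Algebra.lsmul K K V : 𝒜 →ₐ[K] End K V) := by
  have := IsSimpleModule.nontrivial 𝒜 V
  obtain ⟨v, hv⟩ := exists_span_range_eq_top_of_matrix V g
  have hfin : Module.Finite K V := Module.finite_def.2 (hv ▸ Submodule.fg_span (Set.finite_range v))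
  have hle : finrank K V ≤ d + 1 := by
    have := finrank_range_le_card (R := K) v
    rw [Set.finrank, hv, finrank_top, Fintype.card_fin] at this
    exact this
  have : IsSimpleRing 𝒜 := IsSimpleRing.of_ringEquiv g.symm.toRingEquiv inferInstance
  have hinj : Function.Injective (Algebra.lsmul K K V : 𝒜 →ₐ[K] End K V) :=
    RingHom.injective (Algebra.lsmul K K V : 𝒜 →ₐ[K] End K V).toRingHom
  have : Module.Finite K 𝒜 := Module.Finite.equiv g.symm.toLinearEquiv
  have h𝒜 : finrank K 𝒜 = (d + 1) * (d + 1) := by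
    rw [g.toLinearEquiv.finrank_eq, finrank_matrix]; simp
  have hE : finrank K (End K V) = finrank K V * finrank K V := finrank_linearMap K K V V
  have h1 : finrank K 𝒜 ≤ finrank K (End K V) :=
    LinearMap.finrank_le_finrank_of_injective
      (f := (Algebra.lsmul K K V : 𝒜 →ₐ[K] End K V).toLinearMap) hinj
  have hd : finrank K V = d + 1 := by
    rw [h𝒜, hE] at h1
    exact le_antisymm hle (Nat.mul_self_le_mul_self_iff.1 h1)
  refine ⟨hfin, hd, hinj, ?_⟩
  exact (LinearMap.injective_iff_surjective_of_finrank_eq_finrank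
    (f := (Algebra.lsmul K K V : 𝒜 →ₐ[K] End K V).toLinearMap)
    (by rw [h𝒜, hE, hd])).1 hinj

theorem IsAssociatedOrdering.exists_eigenbasis
    (g : 𝒜 ≃ₐ[K] Matrix (Fin (d + 1)) (Fin (d + 1)) K) {A : 𝒜} {E : Fin (d + 1) → 𝒜}
    {θ : Fin (d + 1) → K} (h : IsAssociatedOrdering A E θ) :
    ∃ w : Basis (Fin (d + 1)) K V, (∀ i, A • w i = θ i • w i) ∧
      ∀ i x, E i • x = w.repr x i • w i := by
  obtain ⟨hfin, hd, hbij⟩ := finrank_eq_and_lsmul_bijective V g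
  have hspec : ∀ i, θ i ∈ spectrum K (Algebra.lsmul K K V A) := fun i => by
    have := AlgEquiv.spectrum_eq (AlgEquiv.ofBijective (Algebra.lsmul K K V : 𝒜 →ₐ[K] _) hbij) A
    rw [AlgEquiv.ofBijective_apply] at this
    rw [this]
    exact h.2.1 i
  choose v hv using fun i =>
    (Module.End.hasEigenvalue_iff_mem_spectrum.2 (hspec i)).exists_hasEigenvector
  have hli := Module.End.eigenvectors_linearIndependent' _ θ h.1 v hv
  set w := basisOfLinearIndependentOfCardEqFinrank hli (by rw [hd, Fintype.card_fin]) with hw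
  have hwv : ⇑w = v := coe_basisOfLinearIndependentOfCardEqFinrank _ _
  have heig : ∀ i, (Algebra.lsmul K K V A) (w i) = θ i • w i := fun i => by
    rw [hwv]; exact (hv i).apply_eq_smul
  refine ⟨w, heig, fun i x => ?_⟩
  have hE : ∀ y : V, E i • y = aeval (Algebra.lsmul K K V A)
      (∏ j ∈ Finset.univ.erase i, C (θ i - θ j)⁻¹ * (X - C (θ j))) y := fun y => by
    rw [h.2.2 i, primitiveIdempotent, aeval_algHom_apply]
    rfl
  rw [hE]
  refine w.ext_elem fun k => ?_
  rw [repr_apply_of_eigenbasis (aeval_apply_of_eigenbasis heig _), eval_prod]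
  rcases eq_or_ne k i with rfl | hk
  · rw [Finset.prod_eq_one]
    · simp
    · intro j hj
      have : θ k - θ j ≠ 0 := sub_ne_zero.2 fun e => (Finset.ne_of_mem_erase hj) (h.1 e).symm
      simp [this]
  · rw [Finset.prod_eq_zero (Finset.mem_erase.2 ⟨hk, Finset.mem_univ k⟩) (by simp)]
    simp [hk]

/-- Both eigenlines are the image of the same E_i. This is needed because eigenvalue sequences are
obtained by choice: it forces the one chosen for Φ^⇓ to be the reversal of the one for Φ. -/
theorem eq_of_isAssociatedOrdering (g : 𝒜 ≃ₐ[K] Matrix (Fin (d + 1)) (Fin (d + 1)) K)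
    (V : Type*) [AddCommGroup V] [Module K V] [Module 𝒜 V] [IsScalarTower K 𝒜 V]
    [IsSimpleModule 𝒜 V] {A : 𝒜} {E : Fin (d + 1) → 𝒜} {θ θ' : Fin (d + 1) → K}
    (h : IsAssociatedOrdering A E θ) (h' : IsAssociatedOrdering A E θ') : θ = θ' := by
  obtain ⟨w, hw, hE⟩ := h.exists_eigenbasis V g
  obtain ⟨w', hw', hE'⟩ := h'.exists_eigenbasis V g
  funext i
  have h1 : w' i = w.repr (w' i) i • w i := by
    rw [← hE, hE', Basis.repr_self, Finsupp.single_eq_same, one_smul]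
  have h2 : A • w' i = θ i • w' i := by
    have hs : A • w.repr (w' i) i • w i = w.repr (w' i) i • A • w i :=
      map_smul (Algebra.lsmul K K V A) _ _
    rw [h1, hs, hw, smul_comm]
  rw [hw'] at h2
  exact (smul_left_injective K (w'.ne_zero i) h2).symm

namespace LeonardSystem

theorem isAssociatedOrdering (Φ : LeonardSystem K 𝒜 d) :
    IsAssociatedOrdering Φ.A Φ.E Φ.eigenvalueSeq :=
  Φ.ordering.choose_spec

theorem isAssociatedOrdering_star (Φ : LeonardSystem K 𝒜 d) :
    IsAssociatedOrdering Φ.Astar Φ.Estar Φ.dualEigenvalueSeq :=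
  Φ.ordering_star.choose_spec

/-- E_i B E_j sends x to its j-th coordinate times the (i, j) entry of B times w_i. Nonvanishing of
entries uses faithfulness of the action. -/
theorem isIrredTridiagonal_of_idempotents (g : 𝒜 ≃ₐ[K] Matrix (Fin (d + 1)) (Fin (d + 1)) K)
    {B : 𝒜} {E : Fin (d + 1) → 𝒜} {w : Basis (Fin (d + 1)) K V}
    (hE : ∀ i x, E i • x = w.repr x i • w i)
    (h0 : ∀ i j : Fin (d + 1), 1 < |((i : ℕ) : ℤ) - ((j : ℕ) : ℤ)| → E i * B * E j = 0)
    (h1 : ∀ i j : Fin (d + 1), |((i : ℕ) : ℤ) - ((j : ℕ) : ℤ)| = 1 → E i * B * E j ≠ 0) :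
    IsIrredTridiagonal (LinearMap.toMatrixAlgEquiv w (Algebra.lsmul K K V B)) := by
  have hsmul : ∀ (A : 𝒜) (x : V) (c : K), A • c • x = c • A • x := fun A x c =>
    map_smul (Algebra.lsmul K K V A) c x
  have key : ∀ i j x, (E i * B * E j) • x = (w.repr x j * w.repr (B • w j) i) • w i := by
    intro i j x
    rw [mul_smul, mul_smul, hE j, hsmul, hsmul, hE i, smul_smul]
  refine ⟨fun i j h => ?_, fun i j h hz => h1 i j h ?_⟩
  · have := key i j (w j)
    rw [h0 i j h, zero_smul, Basis.repr_self, Finsupp.single_eq_same, one_mul] at this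
    rw [LinearMap.toMatrixAlgEquiv_apply]
    exact (smul_eq_zero.1 this.symm).resolve_right (w.ne_zero i)
  · refine (finrank_eq_and_lsmul_bijective V g).2.2.1 (LinearMap.ext fun x => ?_)
    rw [LinearMap.toMatrixAlgEquiv_apply] at hz
    have hz' : w.repr (B • w j) i = 0 := hz
    rw [map_zero, LinearMap.zero_apply]
    refine (key i j x).trans ?_
    rw [hz', mul_zero, zero_smul]

theorem exists_isLeonardBases (Φ : LeonardSystem K 𝒜 d)
    (g : 𝒜 ≃ₐ[K] Matrix (Fin (d + 1)) (Fin (d + 1)) K) :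
    ∃ w e : Basis (Fin (d + 1)) K V, IsLeonardBases (Algebra.lsmul K K V Φ.A)
      (Algebra.lsmul K K V Φ.Astar) w e Φ.eigenvalueSeq Φ.dualEigenvalueSeq := by
  obtain ⟨w, hw, hE⟩ := Φ.isAssociatedOrdering.exists_eigenbasis V g
  obtain ⟨e, he, hEs⟩ := Φ.isAssociatedOrdering_star.exists_eigenbasis V g
  exact ⟨w, e, Φ.isAssociatedOrdering.1, Φ.isAssociatedOrdering_star.1, hw, he,
    isIrredTridiagonal_of_idempotents V g hEs Φ.Estar_A_Estar_eq_zero Φ.Estar_A_Estar_ne_zero,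
    isIrredTridiagonal_of_idempotents V g hE Φ.E_Astar_E_eq_zero Φ.E_Astar_E_ne_zero⟩

/-- Existence alone suffices: the chosen sequence comes with a split basis, and uniqueness is never
needed. -/
theorem exists_isSplitPair_firstSplitSeq (Φ : LeonardSystem K 𝒜 d)
    (g : 𝒜 ≃ₐ[K] Matrix (Fin (d + 1)) (Fin (d + 1)) K) :
    ∃ u : Basis (Fin (d + 1)) K V, IsSplitPair (Algebra.lsmul K K V Φ.A)
      (Algebra.lsmul K K V Φ.Astar) u Φ.eigenvalueSeq Φ.dualEigenvalueSeq (Φ.firstSplitSeq V) := by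
  obtain ⟨w, e, H⟩ := Φ.exists_isLeonardBases V g
  obtain ⟨u, c, hc, hu⟩ := H.exists_split
  have hex : ∃ c, Φ.IsFirstSplitSeq V c := ⟨c, hc, u, hu⟩
  have hfs : Φ.firstSplitSeq V = hex.choose := dif_pos hex
  obtain ⟨_, u', h1, h2, h3, h4⟩ := hex.choose_spec
  exact ⟨u', h1, h2, by rw [hfs]; exact h3, h4⟩

theorem dDown_eigenvalueSeq (Φ : LeonardSystem K 𝒜 d)
    (g : 𝒜 ≃ₐ[K] Matrix (Fin (d + 1)) (Fin (d + 1)) K)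
    (V : Type*) [AddCommGroup V] [Module K V] [Module 𝒜 V] [IsScalarTower K 𝒜 V]
    [IsSimpleModule 𝒜 V] :
    Φ.dDown.eigenvalueSeq = fun i => Φ.eigenvalueSeq i.rev :=
  eq_of_isAssociatedOrdering g V Φ.dDown.isAssociatedOrdering Φ.isAssociatedOrdering.rev

theorem dDown_dualEigenvalueSeq (Φ : LeonardSystem K 𝒜 d) :
    Φ.dDown.dualEigenvalueSeq = Φ.dualEigenvalueSeq :=
  rfl

end LeonardSystem

end SimpleModule

/-! ### From the recurrence and the corner entries to the eight identities. -/

section Assembly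

open Module

variable {K : Type*} [Field K] {d : ℕ}

theorem natExtend_comp_rev (f : Fin (d + 1) → K) {k : ℕ} (hk : k ≤ d) :
    natExtend (fun i => f i.rev) k = natExtend f (d - k) := by
  rw [natExtend_of_lt _ (Nat.lt_succ_of_le hk), natExtend_of_lt f (show d - k < d + 1 by omega)]
  congr 1
  ext
  simp [Fin.val_rev]

theorem natExtend_injOn {f : Fin (d + 1) → K} (hf : Function.Injective f) (i j : ℕ) (hi : i ≤ d)
    (hj : j ≤ d) (h : natExtend f i = natExtend f j) : i = j := by
  rw [natExtend_of_lt f (Nat.lt_succ_of_le hi), natExtend_of_lt f (Nat.lt_succ_of_le hj)] at h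
  exact congrArg Fin.val (hf h)

theorem IsLeonardBases.recurrence {V : Type*} [AddCommGroup V] [Module K V] {a b : End K V}
    {w e : Basis (Fin (d + 1)) K V} {θ θs : Fin (d + 1) → K} (H : IsLeonardBases a b w e θ θs)
    {β : K} (hβ : 3 ≤ d →
      (natExtend θ 0 - natExtend θ 3) / (natExtend θ 1 - natExtend θ 2) = β + 1)
    (i : ℕ) (hi : i + 3 ≤ d) :
    natExtend θ i - natExtend θ (i + 3) =
        (β + 1) * (natExtend θ (i + 1) - natExtend θ (i + 2)) ∧
      natExtend θs i - natExtend θs (i + 3) =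
        (β + 1) * (natExtend θs (i + 1) - natExtend θs (i + 2)) := by
  obtain ⟨κ, hκ⟩ := H.exists_recurrence
  have hN : ∀ i, i + 3 ≤ d →
      κ * (natExtend θ i - natExtend θ (i + 3)) = natExtend θ (i + 1) - natExtend θ (i + 2) ∧
      κ * (natExtend θs i - natExtend θs (i + 3)) =
        natExtend θs (i + 1) - natExtend θs (i + 2) := fun i hi => by
    have := hκ ⟨i, by omega⟩ ⟨i + 1, by omega⟩ ⟨i + 2, by omega⟩ ⟨i + 3, by omega⟩ rfl rfl rfl
    simpa only [← natExtend_val] using this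
  have h0 := (hN 0 (by omega)).1
  have h12 : natExtend θ 1 - natExtend θ 2 ≠ 0 := sub_ne_zero.2 fun h => by
    have := natExtend_injOn H.inj 1 2 (by omega) (by omega) h
    omega
  have hβ' := hβ (by omega)
  rw [div_eq_iff h12] at hβ'
  -- The one prescribed ratio fixes κ as the inverse of β + 1, since θ_1 ≠ θ_2; this transfers β to
  -- all other indices and to the dual eigenvalues.
  have hκβ : (β + 1) * κ = 1 := by
    refine mul_right_cancel₀ h12 ?_
    simp only [zero_add] at h0
    linear_combination h0 - κ * hβ'
  obtain ⟨h1, h2⟩ := hN i hi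
  exact ⟨by linear_combination (β + 1) * h1 - (natExtend θ i - natExtend θ (i + 3)) * hκβ,
    by linear_combination (β + 1) * h2 - (natExtend θs i - natExtend θs (i + 3)) * hκβ⟩

section Functional

variable {L : Type*} [Field L] [Algebra K L] {w : L} {θ : ℕ → K} {β : K} {F : K[X] →ₗ[K] K}
  {Nη Dη Nτ Dτ : ℕ → K}

/-- If `F(τ_n) = Nτ_n / Dτ_n` and `F(η_n) = Nη_n / Dη_n` for a functional `F`, then the latter are
combinations of the former. -/
theorem algebraMap_eta_eq_sum_tau (hw : w ≠ 0) (hq1 : w ^ 2 ≠ 1) (hq2 : w ^ 2 ≠ -1)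
    (hβ : algebraMap K L β = w ^ 2 + (w ^ 2)⁻¹)
    (hrec : ∀ i, i + 3 ≤ d → θ i - θ (i + 3) = (β + 1) * (θ (i + 1) - θ (i + 2)))
    (hinj : ∀ i j, i ≤ d → j ≤ d → θ i = θ j → i = j)
    (hη : ∀ n ≤ d, F (∏ k ∈ Finset.range n, (X - C (θ (d - k)))) * Dη n = Nη n)
    (hDη : ∀ n ≤ d, Dη n ≠ 0)
    (hτ : ∀ n ≤ d, F (∏ k ∈ Finset.range n, (X - C (θ k))) * Dτ n = Nτ n)
    (hDτ : ∀ n ≤ d, Dτ n ≠ 0) (i : ℕ) (hi : i ≤ d) :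
    algebraMap K L (Nη i / Dη i) = ∑ h ∈ Finset.range (i + 1), qTriple w h (i - h) (d - i) *
      algebraMap K L ((∏ k ∈ Finset.range (i - h), (X - C (θ (d - k)))).eval (θ 0) *
        Nτ h / Dτ h) := by
  rw [← (eq_div_iff (hDη i hi)).2 (hη i hi),
    algebraMap_apply_prod_rev hw hq1 hq2 hβ hrec hinj F i hi]
  refine Finset.sum_congr rfl fun h hh => ?_
  have hh := Finset.mem_range.1 hh
  rw [(eq_div_iff (hDτ h (by omega))).2 (hτ h (by omega)), eval_prod, mul_div_assoc]
  simp only [eval_sub, eval_X, eval_C]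

/-- Replacing θ_k by θ_{d-k} preserves the recurrence and exchanges τ with η. -/
theorem algebraMap_tau_eq_sum_eta (hw : w ≠ 0) (hq1 : w ^ 2 ≠ 1) (hq2 : w ^ 2 ≠ -1)
    (hβ : algebraMap K L β = w ^ 2 + (w ^ 2)⁻¹)
    (hrec : ∀ i, i + 3 ≤ d → θ i - θ (i + 3) = (β + 1) * (θ (i + 1) - θ (i + 2)))
    (hinj : ∀ i j, i ≤ d → j ≤ d → θ i = θ j → i = j)
    (hη : ∀ n ≤ d, F (∏ k ∈ Finset.range n, (X - C (θ (d - k)))) * Dη n = Nη n)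
    (hDη : ∀ n ≤ d, Dη n ≠ 0)
    (hτ : ∀ n ≤ d, F (∏ k ∈ Finset.range n, (X - C (θ k))) * Dτ n = Nτ n)
    (hDτ : ∀ n ≤ d, Dτ n ≠ 0) (i : ℕ) (hi : i ≤ d) :
    algebraMap K L (Nτ i / Dτ i) = ∑ h ∈ Finset.range (i + 1), qTriple w h (i - h) (d - i) *
      algebraMap K L ((∏ k ∈ Finset.range (i - h), (X - C (θ k))).eval (θ d) *
        Nη h / Dη h) := by
  have hrev : ∀ n ≤ d, ∏ k ∈ Finset.range n, (X - C (θ (d - (d - k)))) =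
      ∏ k ∈ Finset.range n, (X - C (θ k)) := fun n hn =>
    Finset.prod_congr rfl fun k hk => by
      rw [Nat.sub_sub_self (by have := Finset.mem_range.1 hk; omega)]
  have := algebraMap_eta_eq_sum_tau (θ := fun k => θ (d - k)) hw hq1 hq2 hβ
    (fun i hi => by
      have h := hrec (d - (i + 3)) (by omega)
      rw [show d - (i + 3) + 3 = d - i by omega, show d - (i + 3) + 1 = d - (i + 2) by omega,
        show d - (i + 3) + 2 = d - (i + 1) by omega] at h
      linear_combination -h)
    (fun i j hi hj h => by
      have := hinj (d - i) (d - j) (by omega) (by omega) h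
      omega)
    (fun n hn => (congrArg (fun f => F f * Dτ n) (hrev n hn)).trans (hτ n hn)) hDτ hη hDη i hi
  rw [this]
  refine Finset.sum_congr rfl fun h hh => ?_
  rw [hrev _ (by omega), Nat.sub_zero]

end Functional

end Assembly

theorem theorem6p1 {K 𝒜 V : Type*} [Field K] [Ring 𝒜] [Algebra K 𝒜] {d : ℕ}
    (h𝒜 : Nonempty (𝒜 ≃ₐ[K] Matrix (Fin (d + 1)) (Fin (d + 1)) K))
    [AddCommGroup V] [Module K V] [Module 𝒜 V] [IsScalarTower K 𝒜 V] [IsSimpleModule 𝒜 V]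
    (Φ : LeonardSystem K 𝒜 d)
    (p : ParameterArray K d) (hp : p = Φ.parameterArray V)
    -- for `d ≥ 3` only one of the expressions with common value `β + 1` is prescribed
    (β : K) (hβ : 3 ≤ d → (p.theta 0 - p.theta 3) / (p.theta 1 - p.theta 2) = β + 1)
    (q : AlgebraicClosure K) (hq0 : q ≠ 0)
    (hqβ : algebraMap K (AlgebraicClosure K) β = q + q⁻¹) (hq1 : q ≠ 1) (hq2 : q ≠ -1)
    -- `w` is any choice of `q^{1/2}`
    (w : AlgebraicClosure K) (hw : w ^ 2 = q)
    (i : ℕ) (hi1 : 1 ≤ i) (hid : i ≤ d) :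
    (algebraMap K (AlgebraicClosure K) (p.phiUp i / p.thetaStarUp i) =
      ∑ h ∈ Finset.range (i + 1), qTriple w h (i - h) (d - i) *
        algebraMap K (AlgebraicClosure K)
          ((p.eta (i - h)).eval (p.theta 0) * p.varphiUp h / p.thetaStarUp h)) ∧
    (algebraMap K (AlgebraicClosure K) (p.varphiDown i / p.thetaStarDown i) =
      ∑ h ∈ Finset.range (i + 1), qTriple w h (i - h) (d - i) *
        algebraMap K (AlgebraicClosure K)
          ((p.eta (i - h)).eval (p.theta 0) * p.phiDown h / p.thetaStarDown h)) ∧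
    (algebraMap K (AlgebraicClosure K) (p.varphiUp i / p.thetaStarUp i) =
      ∑ h ∈ Finset.range (i + 1), qTriple w h (i - h) (d - i) *
        algebraMap K (AlgebraicClosure K)
          ((p.tau (i - h)).eval (p.theta d) * p.phiUp h / p.thetaStarUp h)) ∧
    (algebraMap K (AlgebraicClosure K) (p.phiDown i / p.thetaStarDown i) =
      ∑ h ∈ Finset.range (i + 1), qTriple w h (i - h) (d - i) *
        algebraMap K (AlgebraicClosure K)
          ((p.tau (i - h)).eval (p.theta d) * p.varphiDown h / p.thetaStarDown h)) ∧
    (algebraMap K (AlgebraicClosure K) (p.phiDown i / p.thetaUp i) =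
      ∑ h ∈ Finset.range (i + 1), qTriple w h (i - h) (d - i) *
        algebraMap K (AlgebraicClosure K)
          ((p.etaStar (i - h)).eval (p.thetaStar 0) * p.varphiUp h / p.thetaUp h)) ∧
    (algebraMap K (AlgebraicClosure K) (p.varphiDown i / p.thetaDown i) =
      ∑ h ∈ Finset.range (i + 1), qTriple w h (i - h) (d - i) *
        algebraMap K (AlgebraicClosure K)
          ((p.etaStar (i - h)).eval (p.thetaStar 0) * p.phiUp h / p.thetaDown h)) ∧
    (algebraMap K (AlgebraicClosure K) (p.varphiUp i / p.thetaUp i) =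
      ∑ h ∈ Finset.range (i + 1), qTriple w h (i - h) (d - i) *
        algebraMap K (AlgebraicClosure K)
          ((p.tauStar (i - h)).eval (p.thetaStar d) * p.phiDown h / p.thetaUp h)) ∧
    (algebraMap K (AlgebraicClosure K) (p.phiUp i / p.thetaDown i) =
      ∑ h ∈ Finset.range (i + 1), qTriple w h (i - h) (d - i) *
        algebraMap K (AlgebraicClosure K)
          ((p.tauStar (i - h)).eval (p.thetaStar d) * p.varphiDown h / p.thetaDown h)) := by
  obtain ⟨g⟩ := h𝒜
  subst hw
  have hw0 : w ≠ 0 := fun h => hq0 (by rw [h]; simp)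
  obtain ⟨wb, eb, H⟩ := Φ.exists_isLeonardBases V g
  obtain ⟨u, S⟩ := Φ.exists_isSplitPair_firstSplitSeq V g
  obtain ⟨v, S'⟩ := Φ.dDown.exists_isSplitPair_firstSplitSeq V g
  rw [Φ.dDown_eigenvalueSeq g V, Φ.dDown_dualEigenvalueSeq] at S'
  change IsSplitPair (Algebra.lsmul K K V Φ.A) (Algebra.lsmul K K V Φ.Astar) v _ _ _ at S'
  set a := Algebra.lsmul K K V Φ.A with ha
  set b := Algebra.lsmul K K V Φ.Astar with hb
  -- The split basis of Φ^⇓ has the eigenvalues of A reversed, so the eigenbasis of A is reversed to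
  -- match; this swaps the two corner entries of p(A*), while e is unaffected.
  set wr : Module.Basis (Fin (d + 1)) K V := wb.reindex Fin.revPerm with hwr
  have hwr_apply : ∀ i, wr i = wb i.rev := fun i => by simp [hwr]
  have hwr_eig : ∀ i, a (wr i) = (fun i => Φ.eigenvalueSeq i.rev) i • wr i := fun i => by
    rw [hwr_apply, H.eig]
  have hwr_inj : Function.Injective fun i : Fin (d + 1) => Φ.eigenvalueSeq i.rev :=
    H.inj.comp Fin.rev_injective
  have hdiag0 : diagonalEntry wr b 0 = diagonalEntry wb b (Fin.last d) := by
    ext n; simp [diagonalEntry_apply, hwr]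
  have hdiagd : diagonalEntry wr b (Fin.last d) = diagonalEntry wb b 0 := by
    ext n; simp [diagonalEntry_apply, hwr]
  have hθ : p.theta = natExtend Φ.eigenvalueSeq := by rw [hp]; rfl
  have hθs : p.thetaStar = natExtend Φ.dualEigenvalueSeq := by rw [hp]; rfl
  have hφ : ∀ k, p.varphi k = natExtend (Φ.firstSplitSeq V) (k - 1) := fun k => by rw [hp]; rfl
  have hϕ : ∀ k, p.phi k = natExtend (Φ.dDown.firstSplitSeq V) (k - 1) := fun k => by rw [hp]; rfl
  have hrec := H.recurrence (β := β) (by rw [← hθ]; exact hβ)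
  have hinj := natExtend_injOn H.inj
  have hinjs := natExtend_injOn H.inj_star
  have hrevθ : ∀ k ≤ d, natExtend (fun i => Φ.eigenvalueSeq i.rev) k = p.theta (d - k) :=
    fun k hk => by rw [natExtend_comp_rev _ hk, hθ]
  rw [← hθ, ← hθs] at hrec
  rw [← hθ] at hinj
  rw [← hθs] at hinjs
  have hDθ : ∀ n ≤ d, p.thetaUp n ≠ 0 := fun n hn => Finset.prod_ne_zero_iff.2 fun k hk =>
    sub_ne_zero.2 fun h => by
      have := Finset.mem_range.1 hk
      have := hinj _ _ (by omega) (by omega) h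
      omega
  have hDθd : ∀ n ≤ d, p.thetaDown n ≠ 0 := fun n hn => Finset.prod_ne_zero_iff.2 fun k hk =>
    sub_ne_zero.2 fun h => by
      have := Finset.mem_range.1 hk
      have := hinj _ _ (by omega) (by omega) h
      omega
  have hDs : ∀ n ≤ d, p.thetaStarUp n ≠ 0 := fun n hn => Finset.prod_ne_zero_iff.2 fun k hk =>
    sub_ne_zero.2 fun h => by
      have := Finset.mem_range.1 hk
      have := hinjs _ _ (by omega) (by omega) h
      omega
  have hDsd : ∀ n ≤ d, p.thetaStarDown n ≠ 0 := fun n hn => Finset.prod_ne_zero_iff.2 fun k hk =>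
    sub_ne_zero.2 fun h => by
      have := Finset.mem_range.1 hk
      have := hinjs _ _ (by omega) (by omega) h
      omega
  have hvU : ∀ n, p.varphiUp n = ∏ k ∈ Finset.range n, natExtend (Φ.firstSplitSeq V) k :=
    fun n => Finset.prod_congr rfl fun k _ => hφ (k + 1)
  have hvD : ∀ n, p.varphiDown n =
      ∏ k ∈ Finset.range n, natExtend (Φ.firstSplitSeq V) (d - k - 1) :=
    fun n => Finset.prod_congr rfl fun k _ => hφ (d - k)
  have hpU : ∀ n, p.phiUp n = ∏ k ∈ Finset.range n, natExtend (Φ.dDown.firstSplitSeq V) k :=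
    fun n => Finset.prod_congr rfl fun k _ => hϕ (k + 1)
  have hpD : ∀ n, p.phiDown n =
      ∏ k ∈ Finset.range n, natExtend (Φ.dDown.firstSplitSeq V) (d - k - 1) :=
    fun n => Finset.prod_congr rfl fun k _ => hϕ (d - k)
  -- Each of the four corner functionals is evaluated on the τ (or τ*) and on the η (or η*), one
  -- evaluation coming from Φ and the other from Φ^⇓.
  have t1 : ∀ n ≤ d, diagonalEntry eb a 0 (∏ k ∈ Finset.range n, (X - C (p.theta k))) *
      p.thetaStarUp n = p.varphiUp n := fun n hn => by
    rw [hvU, ← S.diagonalEntry_zero_tau H.eig_star H.inj_star hn, ParameterArray.thetaStarUp,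
      hθ, hθs]
  have e1 : ∀ n ≤ d, diagonalEntry eb a 0 (∏ k ∈ Finset.range n, (X - C (p.theta (d - k)))) *
      p.thetaStarUp n = p.phiUp n := fun n hn => by
    rw [hpU, ← S'.diagonalEntry_zero_tau H.eig_star H.inj_star hn, ParameterArray.thetaStarUp, hθs]
    congr 2
    exact Finset.prod_congr rfl fun k hk => by
      rw [hrevθ k (by have := Finset.mem_range.1 hk; omega)]
  have e2 : ∀ n ≤ d, diagonalEntry eb a (Fin.last d)
      (∏ k ∈ Finset.range n, (X - C (p.theta (d - k)))) * p.thetaStarDown n = p.varphiDown n :=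
    fun n hn => by
    rw [hvD, ← S.diagonalEntry_last_eta H.eig_star H.inj_star hn, ParameterArray.thetaStarDown,
      hθ, hθs]
  have t2 : ∀ n ≤ d, diagonalEntry eb a (Fin.last d)
      (∏ k ∈ Finset.range n, (X - C (p.theta k))) * p.thetaStarDown n = p.phiDown n :=
    fun n hn => by
    rw [hpD, ← S'.diagonalEntry_last_eta H.eig_star H.inj_star hn, ParameterArray.thetaStarDown,
      hθs]
    congr 2
    exact Finset.prod_congr rfl fun k hk => by
      rw [hrevθ (d - k) (by omega),
        Nat.sub_sub_self (by have := Finset.mem_range.1 hk; omega)]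
  have t3 : ∀ n ≤ d, diagonalEntry wb b 0 (∏ k ∈ Finset.range n, (X - C (p.thetaStar k))) *
      p.thetaUp n = p.varphiUp n := fun n hn => by
    rw [hvU, ← S.diagonalEntry_star_zero_tau H.eig H.inj hn, ParameterArray.thetaUp, hθ, hθs]
  have e3 : ∀ n ≤ d, diagonalEntry wb b 0
      (∏ k ∈ Finset.range n, (X - C (p.thetaStar (d - k)))) * p.thetaUp n = p.phiDown n :=
    fun n hn => by
    -- The last vector of the reversed basis is w_0, hence phi appears in descending order against
    -- the differences θ_0 - θ_{k+1}.
    rw [hpD, ← S'.diagonalEntry_star_last_eta hwr_eig hwr_inj hn, hdiagd, hθs]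
    congr 1
    exact Finset.prod_congr rfl fun k hk => by
      have := Finset.mem_range.1 hk
      rw [hrevθ _ le_rfl, hrevθ _ (by omega), Nat.sub_self, Nat.sub_sub_self (by omega)]
  have e4 : ∀ n ≤ d, diagonalEntry wb b (Fin.last d)
      (∏ k ∈ Finset.range n, (X - C (p.thetaStar (d - k)))) * p.thetaDown n = p.varphiDown n :=
    fun n hn => by
    rw [hvD, ← S.diagonalEntry_star_last_eta H.eig H.inj hn, ParameterArray.thetaDown, hθ, hθs]
  have t4 : ∀ n ≤ d, diagonalEntry wb b (Fin.last d)
      (∏ k ∈ Finset.range n, (X - C (p.thetaStar k))) * p.thetaDown n = p.phiUp n :=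
    fun n hn => by
    rw [hpU, ← S'.diagonalEntry_star_zero_tau hwr_eig hwr_inj hn, hdiag0, hθs]
    congr 1
    exact Finset.prod_congr rfl fun k hk => by
      have := Finset.mem_range.1 hk
      rw [hrevθ _ (by omega), hrevθ _ (by omega), Nat.sub_zero]
  have hr := fun i hi => (hrec i hi).1
  have hrs := fun i hi => (hrec i hi).2
  exact ⟨algebraMap_eta_eq_sum_tau hw0 hq1 hq2 hqβ hr hinj e1 hDs t1 hDs i hid,
    algebraMap_eta_eq_sum_tau hw0 hq1 hq2 hqβ hr hinj e2 hDsd t2 hDsd i hid,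
    algebraMap_tau_eq_sum_eta hw0 hq1 hq2 hqβ hr hinj e1 hDs t1 hDs i hid,
    algebraMap_tau_eq_sum_eta hw0 hq1 hq2 hqβ hr hinj e2 hDsd t2 hDsd i hid,
    algebraMap_eta_eq_sum_tau hw0 hq1 hq2 hqβ hrs hinjs e3 hDθ t3 hDθ i hid,
    algebraMap_eta_eq_sum_tau hw0 hq1 hq2 hqβ hrs hinjs e4 hDθd t4 hDθd i hid,
    algebraMap_tau_eq_sum_eta hw0 hq1 hq2 hqβ hrs hinjs e3 hDθ t3 hDθ i hid,
    algebraMap_tau_eq_sum_eta hw0 hq1 hq2 hqβ hrs hinjs e4 hDθd t4 hDθd i hid⟩
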